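/- Let $k$ be a field of characteristic zero and let $q\in k^\times$ not be a root of unity. Let $k_q[x,y]=k\langle x,y\rangle/(xy-qyx)$ be the quantum plane and let $D=k_q(x,y)$ be its division ring of fractions. There is a unique $k$-algebra automorphism $\varphi$ of $D$ with $$\varphi(x)=(y^{-1}-q^{-1}y)x^{-1},\qquad \varphi(y)=-y^{-1},$$ and it has order $2$. Let $G=\langle\varphi\rangle$ and $D^G=\{r\in D:\ \sigma(r)=r\ \text{for all }\sigma\in G\}$. Then $D^G\cong D$ as $k$-algebras. Moreover, put $\Lambda=y^{-1}-q^{-1}y$ and $$h=(y+y^{-1})^{-1}(x-\Lambda x^{-1}),\qquad g=(y+y^{-1})^{-1}(xy+\Lambda x^{-1}y^{-1}).$$ Then $h$ and $g$ lie in $D^G$ and satisfy $hg-qgh=1-q$; the division subring $R$ of $D$ generated by $k$, $h$ and $g$ is equal to $D^G$; and $D$ has dimension $2$ over $R$, both as a left and as a right $R$-vector space. -/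

import Mathlib

open scoped nonZeroDivisors

/-- The defining relation `x y = q y x` of the quantum plane; the generator with index `0` of the
free algebra is `x`, the one with index `1` is `y`. -/
inductive QuantumPlane.Rel (k : Type*) [Field k] (q : kˣ) :
    FreeAlgebra k (Fin 2) → FreeAlgebra k (Fin 2) → Prop
  | comm : QuantumPlane.Rel k q (FreeAlgebra.ι k 0 * FreeAlgebra.ι k 1)
      ((q : k) • (FreeAlgebra.ι k 1 * FreeAlgebra.ι k 0))

/-- The quantum plane `k_q[x, y] = k⟨x, y⟩ / (x y - q y x)`. -/
abbrev QuantumPlane (k : Type*) [Field k] (q : kˣ) : Type _ :=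
  RingQuot (QuantumPlane.Rel k q)

namespace QuantumPlane

variable (k : Type*) [Field k] (q : kˣ)

/-- The generator `x` of the quantum plane. -/
noncomputable def x : QuantumPlane k q :=
  RingQuot.mkAlgHom k (Rel k q) (FreeAlgebra.ι k 0)

/-- The generator `y` of the quantum plane. -/
noncomputable def y : QuantumPlane k q :=
  RingQuot.mkAlgHom k (Rel k q) (FreeAlgebra.ι k 1)

theorem x_mul_y : x k q * y k q = (q : k) • (y k q * x k q) := by
  have h := RingQuot.mkAlgHom_rel k (Rel.comm (k := k) (q := q))
  simpa [x, y] using h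

theorem x_mul_y_pow (n : ℕ) : x k q * y k q ^ n = (q : k) ^ n • (y k q ^ n * x k q) := by
  induction n with
  | zero => simp
  | succ n ih =>
    rw [pow_succ, ← mul_assoc, ih, smul_mul_assoc, mul_assoc, x_mul_y, mul_smul_comm, smul_smul,
      ← mul_assoc, ← pow_succ, ← pow_succ]

theorem x_pow_mul_y_pow (m n : ℕ) :
    x k q ^ m * y k q ^ n = (q : k) ^ (m * n) • (y k q ^ n * x k q ^ m) := by
  induction m with
  | zero => simp
  | succ m ih =>
    rw [pow_succ, mul_assoc, x_mul_y_pow, mul_smul_comm, ← mul_assoc, ih, smul_mul_assoc,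
      smul_smul, mul_assoc, ← pow_add]
    congr 2
    ring

/-- The monomial `y ^ i * x ^ j`. -/
noncomputable def mon (p : ℕ × ℕ) : QuantumPlane k q := y k q ^ p.1 * x k q ^ p.2

theorem mon_mul (p r : ℕ × ℕ) :
    mon k q p * mon k q r = (q : k) ^ (p.2 * r.1) • mon k q (p + r) := by
  simp only [mon, Prod.fst_add, Prod.snd_add]
  rw [mul_assoc, ← mul_assoc (x k q ^ p.2), x_pow_mul_y_pow, smul_mul_assoc, mul_smul_comm,
    pow_add, pow_add]
  simp only [mul_assoc]

/-- The action of `x` on the space with basis the monomials. -/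
noncomputable def actX : Module.End k (ℕ × ℕ →₀ k) :=
  Finsupp.linearCombination k fun p => Finsupp.single (p.1, p.2 + 1) ((q : k) ^ p.1)

/-- The action of `y` on the space with basis the monomials. -/
noncomputable def actY : Module.End k (ℕ × ℕ →₀ k) :=
  Finsupp.linearCombination k fun p => Finsupp.single (p.1 + 1, p.2) (1 : k)

theorem actX_single (p : ℕ × ℕ) :
    actX k q (Finsupp.single p 1) = Finsupp.single (p.1, p.2 + 1) ((q : k) ^ p.1) := by
  simp [actX]

theorem actY_single (p : ℕ × ℕ) (c : k) :
    actY k (Finsupp.single p c) = Finsupp.single (p.1 + 1, p.2) c := by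
  simp [actY]

/-- The left regular representation on the space with basis the monomials. -/
noncomputable def act : QuantumPlane k q →ₐ[k] Module.End k (ℕ × ℕ →₀ k) :=
  RingQuot.liftAlgHom k ⟨FreeAlgebra.lift k ![actX k q, actY k], by
    rintro _ _ ⟨⟩
    simp only [map_mul, map_smul, FreeAlgebra.lift_ι_apply, Matrix.cons_val_zero,
      Matrix.cons_val_one]
    refine Finsupp.lhom_ext' fun p => LinearMap.ext_ring ?_
    simp [Module.End.mul_apply, actX, actY, pow_succ, mul_comm]⟩

theorem act_x : act k q (x k q) = actX k q := by
  simp [act, x]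

theorem act_y : act k q (y k q) = actY k := by
  simp [act, y]

/-- Coordinates with respect to the monomials. -/
noncomputable def coord : QuantumPlane k q →ₗ[k] (ℕ × ℕ →₀ k) :=
  (LinearMap.applyₗ (Finsupp.single (0, 0) 1 : ℕ × ℕ →₀ k)).comp (act k q).toLinearMap

theorem coord_mon (p : ℕ × ℕ) : coord k q (mon k q p) = Finsupp.single p 1 := by
  have hx : ∀ j : ℕ, (actX k q ^ j) (Finsupp.single (0, 0) 1) = Finsupp.single (0, j) 1 := by
    intro j
    induction j with
    | zero => simp
    | succ j ih => rw [pow_succ', Module.End.mul_apply, ih, actX_single]; simp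
  have hy : ∀ i j : ℕ, (actY k ^ i) (Finsupp.single (0, j) 1) = Finsupp.single (i, j) 1 := by
    intro i j
    induction i with
    | zero => simp
    | succ i ih => rw [pow_succ', Module.End.mul_apply, ih, actY_single]
  change (act k q (mon k q p)) (Finsupp.single (0, 0) 1) = _
  rw [mon, map_mul, map_pow, map_pow, act_x, act_y, Module.End.mul_apply, hx, hy]

/-- The linear combination of monomials with given coefficients. -/
noncomputable def ofCoord : (ℕ × ℕ →₀ k) →ₗ[k] QuantumPlane k q :=
  Finsupp.linearCombination k (mon k q)

theorem coord_ofCoord (f : ℕ × ℕ →₀ k) : coord k q (ofCoord k q f) = f := by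
  have h : (coord k q).comp (ofCoord k q) = LinearMap.id := by
    refine Finsupp.lhom_ext' fun p => LinearMap.ext_ring ?_
    simp [ofCoord, coord_mon]
  exact LinearMap.congr_fun h f

theorem ofCoord_surjective : Function.Surjective (ofCoord k q) := by
  rw [← LinearMap.range_eq_top, ofCoord, Finsupp.range_linearCombination, eq_top_iff]
  have hmem : ∀ p, mon k q p ∈ Submodule.span k (Set.range (mon k q)) :=
    fun p => Submodule.subset_span ⟨p, rfl⟩
  have hmul : ∀ a ∈ Submodule.span k (Set.range (mon k q)),
      ∀ b ∈ Submodule.span k (Set.range (mon k q)),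
        a * b ∈ Submodule.span k (Set.range (mon k q)) := by
    intro a ha b hb
    have h := Submodule.mul_mem_mul ha hb
    rw [Submodule.span_mul_span] at h
    refine Submodule.span_le.2 ?_ h
    rintro _ ⟨_, ⟨p, rfl⟩, _, ⟨r, rfl⟩, rfl⟩
    simp only [mon_mul]
    exact Submodule.smul_mem _ _ (hmem _)
  rintro a -
  obtain ⟨a, rfl⟩ := RingQuot.mkAlgHom_surjective k (Rel k q) a
  induction a using FreeAlgebra.induction with
  | grade0 r =>
    have h1 : (1 : QuantumPlane k q) ∈ Submodule.span k (Set.range (mon k q)) := by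
      simpa [mon] using hmem (0, 0)
    rw [AlgHom.commutes, Algebra.algebraMap_eq_smul_one]
    exact Submodule.smul_mem _ _ h1
  | grade1 i =>
    fin_cases i
    · simpa [mon, x] using hmem (0, 1)
    · simpa [mon, y] using hmem (1, 0)
  | mul a b ha hb => rw [map_mul]; exact hmul _ ha _ hb
  | add a b ha hb => rw [map_add]; exact Submodule.add_mem _ ha hb

theorem ofCoord_mul (f g : ℕ × ℕ →₀ k) :
    ofCoord k q f * ofCoord k q g =
      ∑ p ∈ f.support, ∑ r ∈ g.support,
        (f p * g r * (q : k) ^ (p.2 * r.1)) • mon k q (p + r) := by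
  simp only [ofCoord, Finsupp.linearCombination_apply, Finsupp.sum, Finset.sum_mul_sum,
    smul_mul_smul_comm, mon_mul, smul_smul]

theorem coord_mul (f g : ℕ × ℕ →₀ k) :
    coord k q (ofCoord k q f * ofCoord k q g) =
      ∑ p ∈ f.support, ∑ r ∈ g.support,
        Finsupp.single (p + r) (f p * g r * (q : k) ^ (p.2 * r.1)) := by
  simp [ofCoord_mul, coord_mon]

instance instNontrivial : Nontrivial (QuantumPlane k q) := by
  refine ⟨⟨ofCoord k q (Finsupp.single (0, 0) 1), 0, fun h => ?_⟩⟩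
  have h' := congrArg (coord k q) h
  rw [coord_ofCoord, map_zero] at h'
  simp at h'

instance instNoZeroDivisors : NoZeroDivisors (QuantumPlane k q) where
  eq_zero_or_eq_zero_of_mul_eq_zero := by
    intro a b hab
    obtain ⟨f, rfl⟩ := ofCoord_surjective k q a
    obtain ⟨g, rfl⟩ := ofCoord_surjective k q b
    by_contra! hne
    have hf : f.support.Nonempty :=
      Finsupp.support_nonempty_iff.2 fun h => hne.1 (by rw [h, map_zero])
    have hg : g.support.Nonempty :=
      Finsupp.support_nonempty_iff.2 fun h => hne.2 (by rw [h, map_zero])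
    obtain ⟨p, hp, r, hr, hu⟩ := UniqueSums.uniqueAdd_of_nonempty hf hg
    have h0 := congrArg (fun c => coord k q c (p + r)) hab
    simp only [coord_mul, map_zero, Finsupp.coe_zero, Pi.zero_apply, Finsupp.finsetSum_apply,
      Finsupp.single_apply] at h0
    rw [Finset.sum_eq_single p, Finset.sum_eq_single r] at h0
    · rw [if_pos rfl] at h0
      exact mul_ne_zero (mul_ne_zero (Finsupp.mem_support_iff.1 hp) (Finsupp.mem_support_iff.1 hr))
        (pow_ne_zero _ q.ne_zero) h0
    · intro r' hr' hne'
      exact if_neg fun h => hne' (hu hp hr' h).2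
    · intro h; exact absurd hr h
    · intro p' hp' hne'
      exact Finset.sum_eq_zero fun r' hr' => if_neg fun h => hne' (hu hp' hr' h).1
    · intro h; exact absurd hp h

/-- The coefficient families supported in the box `[0, n) × [0, n)`. -/
noncomputable def box (n : ℕ) : Submodule k (ℕ × ℕ →₀ k) :=
  Finsupp.supported k k (↑(Finset.range n ×ˢ Finset.range n) : Set (ℕ × ℕ))

theorem mem_box (n : ℕ) (f : ℕ × ℕ →₀ k) :
    f ∈ box k n ↔ ∀ p ∈ f.support, p.1 < n ∧ p.2 < n := by
  simp only [box, Finsupp.mem_supported, Set.subset_def, Finset.mem_coe, Finset.mem_product,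
    Finset.mem_range]

theorem exists_mem_box (f : ℕ × ℕ →₀ k) : ∃ d, ∀ n, d ≤ n → f ∈ box k n := by
  refine ⟨f.support.sup (fun p => p.1 + p.2) + 1, fun n hn => (mem_box k n f).2 fun p hp => ?_⟩
  have h : p.1 + p.2 ≤ f.support.sup (fun p => p.1 + p.2) :=
    Finset.le_sup (f := fun p : ℕ × ℕ => p.1 + p.2) hp
  omega

theorem finrank_box (n : ℕ) : Module.finrank k (box k n) = n * n := by
  rw [box, (Finsupp.supportedEquivFinsupp _).finrank_eq]
  simp

instance instFiniteBox (n : ℕ) : Module.Finite k (box k n) :=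
  Module.Finite.equiv (Finsupp.supportedEquivFinsupp (R := k) (M := k)
    (↑(Finset.range n ×ˢ Finset.range n) : Set (ℕ × ℕ))).symm

instance instFreeBox (n : ℕ) : Module.Free k (box k n) :=
  Module.Free.of_equiv (Finsupp.supportedEquivFinsupp (R := k) (M := k)
    (↑(Finset.range n ×ˢ Finset.range n) : Set (ℕ × ℕ))).symm

theorem coord_mul_mem_box {m n : ℕ} {f g : ℕ × ℕ →₀ k} (hf : f ∈ box k m) (hg : g ∈ box k n) :
    coord k q (ofCoord k q f * ofCoord k q g) ∈ box k (m + n) := by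
  rw [coord_mul]
  refine Submodule.sum_mem _ fun p hp => Submodule.sum_mem _ fun r hr => ?_
  refine Finsupp.single_mem_supported k _ ?_
  have h1 := (mem_box k m f).1 hf p hp
  have h2 := (mem_box k n g).1 hg r hr
  simp only [Finset.coe_product, Finset.coe_range, Set.mem_prod, Set.mem_Iio, Prod.fst_add,
    Prod.snd_add]
  omega

theorem exists_common_multiple (r s : QuantumPlane k q) (hs : s ≠ 0) :
    ∃ a b : QuantumPlane k q, a ≠ 0 ∧ a * r = b * s := by
  obtain ⟨f, rfl⟩ := ofCoord_surjective k q r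
  obtain ⟨g, rfl⟩ := ofCoord_surjective k q s
  obtain ⟨d₁, h₁⟩ := exists_mem_box k f
  obtain ⟨d₂, h₂⟩ := exists_mem_box k g
  obtain ⟨d, hd0, hf, hg⟩ : ∃ d, 0 < d ∧ f ∈ box k d ∧ g ∈ box k d :=
    ⟨d₁ + d₂ + 1, by omega, h₁ _ (by omega), h₂ _ (by omega)⟩
  let T : (box k (3 * d) × box k (3 * d)) →ₗ[k] box k (3 * d + d) :=
    LinearMap.codRestrict (box k (3 * d + d))
      ((coord k q).comp
        (((LinearMap.mulRight k (ofCoord k q f)).comp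
            ((ofCoord k q).comp ((box k (3 * d)).subtype.comp (LinearMap.fst k _ _)))) -
          ((LinearMap.mulRight k (ofCoord k q g)).comp
            ((ofCoord k q).comp ((box k (3 * d)).subtype.comp (LinearMap.snd k _ _))))))
      (by
        rintro ⟨u, v⟩
        simp only [LinearMap.comp_apply, LinearMap.sub_apply, map_sub]
        exact Submodule.sub_mem _ (coord_mul_mem_box k q u.2 hf) (coord_mul_mem_box k q v.2 hg))
  have hT : LinearMap.ker T ≠ ⊥ := by
    have : Module.Free k (box k (3 * d)) := instFreeBox k _
    refine LinearMap.ker_ne_bot_of_finrank_lt (K := k) (V := box k (3 * d) × box k (3 * d))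
      (V₂ := box k (3 * d + d)) (f := T) ?_
    rw [Module.finrank_prod, finrank_box, finrank_box]
    nlinarith
  obtain ⟨⟨u, v⟩, huv, hne⟩ := (Submodule.ne_bot_iff _).1 hT
  have hinj : ∀ c : QuantumPlane k q, coord k q c = 0 → c = 0 := by
    intro c hc
    obtain ⟨e, rfl⟩ := ofCoord_surjective k q c
    rw [coord_ofCoord] at hc
    rw [hc, map_zero]
  have hEq : ofCoord k q u * ofCoord k q f = ofCoord k q v * ofCoord k q g := by
    refine sub_eq_zero.1 (hinj _ ?_)
    exact congrArg Subtype.val (LinearMap.mem_ker.1 huv)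
  refine ⟨ofCoord k q u, ofCoord k q v, fun hu => hne ?_, hEq⟩
  have hv : ofCoord k q v = 0 := by
    rw [hu, zero_mul] at hEq
    exact (mul_eq_zero.1 hEq.symm).resolve_right hs
  have hu' := congrArg (coord k q) hu
  have hv' := congrArg (coord k q) hv
  rw [coord_ofCoord, map_zero] at hu' hv'
  exact Prod.ext (Subtype.ext hu') (Subtype.ext hv')

/-- The nonzero elements of the quantum plane form an Ore set. -/
noncomputable instance instOreSet : OreLocalization.OreSet (QuantumPlane k q)⁰ :=
  Classical.choice <| OreLocalization.nonempty_oreSet_iff_of_noZeroDivisors.2 fun r s => by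
    obtain ⟨a, b, ha, hab⟩ := exists_common_multiple k q r s (nonZeroDivisors.ne_zero s.2)
    exact ⟨b, ⟨a, mem_nonZeroDivisors_of_ne_zero ha⟩, hab⟩

end QuantumPlane

/-- The `q`-division ring `D = k_q(x, y)`: the division ring of fractions of the quantum plane. -/
def QDivisionRing (k : Type*) [Field k] (q : kˣ) : Type _ :=
  OreLocalization (QuantumPlane k q)⁰ (QuantumPlane k q)

namespace QDivisionRing

variable (k : Type*) [Field k] (q : kˣ)

noncomputable instance instDivisionRing : DivisionRing (QDivisionRing k q) :=
  inferInstanceAs (DivisionRing (OreLocalization (QuantumPlane k q)⁰ (QuantumPlane k q)))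

noncomputable instance instAlgebra : Algebra k (QDivisionRing k q) :=
  inferInstanceAs (Algebra k (OreLocalization (QuantumPlane k q)⁰ (QuantumPlane k q)))

/-- The embedding of the quantum plane into its division ring of fractions. -/
noncomputable def ofPlane : QuantumPlane k q →ₐ[k] QDivisionRing k q where
  __ := (OreLocalization.numeratorRingHom :
    QuantumPlane k q →+* OreLocalization (QuantumPlane k q)⁰ (QuantumPlane k q))
  commutes' _ := rfl

/-- The generator `x` of `k_q(x, y)`. -/
noncomputable def x : QDivisionRing k q := ofPlane k q (QuantumPlane.x k q)

/-- The generator `y` of `k_q(x, y)`. -/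
noncomputable def y : QDivisionRing k q := ofPlane k q (QuantumPlane.y k q)

/-- The element `Λ = y⁻¹ - q⁻¹ y`. -/
noncomputable def Lam : QDivisionRing k q := (y k q)⁻¹ - (q : k)⁻¹ • y k q

/-- The element `h = (y + y⁻¹)⁻¹ (x - Λ x⁻¹)`. -/
noncomputable def h : QDivisionRing k q :=
  (y k q + (y k q)⁻¹)⁻¹ * (x k q - Lam k q * (x k q)⁻¹)

/-- The element `g = (y + y⁻¹)⁻¹ (x y + Λ x⁻¹ y⁻¹)`. -/
noncomputable def g : QDivisionRing k q :=
  (y k q + (y k q)⁻¹)⁻¹ * (x k q * y k q + Lam k q * (x k q)⁻¹ * (y k q)⁻¹)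

/-- The division subring, containing `k`, generated by `h` and `g`. (Mathlib's `Subfield` of a
division ring is a division subring; commutativity is not required.) -/
noncomputable def R : Subfield (QDivisionRing k q) :=
  Subfield.closure (Set.range (algebraMap k (QDivisionRing k q)) ∪ {h k q, g k q})

/-- `φ` sends `x` to `(y⁻¹ - q⁻¹ y) x⁻¹` and `y` to `-y⁻¹`. -/
def IsPhi (φ : QDivisionRing k q ≃ₐ[k] QDivisionRing k q) : Prop :=
  φ (x k q) = ((y k q)⁻¹ - (q : k)⁻¹ • y k q) * (x k q)⁻¹ ∧ φ (y k q) = -(y k q)⁻¹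

end QDivisionRing

/-! Write `u = y`, `X = x`, `Z = Λ x⁻¹`, `t = u + u⁻¹` and `w = u - u⁻¹`. The involution `φ`
exchanges `X` and `Z` and sends `u` to `-u⁻¹`, so `t` changes sign and `w` is fixed. Hence `h = t⁻¹
(X - Z)` and `g = t⁻¹ (X u + Z u⁻¹)` are fixed, and every element of `R` is fixed.

The substance is that `D = R + R y`. Products of `h` and `g` have a normal form `A X² + B Z² + C`
with coefficients in a commutative field containing `y`, because `X Z` and `Z X` lie in that field.
Comparing coefficients gives the Weyl relation and `w (1 - g h) = q h² - q⁻² g²` (`weyl_relation`,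
`w_mul_v`). The factor `1 - g h` is nonzero, so `w` lies in `R`, and so does `t² = w² + 4`. Both `t
h t` and `t g t` are polynomials in `h`, `g`, `w` (`t_mul_h_mul_t`, `t_mul_g_mul_t`), so `t h` and
`t g` lie in `R t`. Since `2 y = w + t`, the space `R + R y` is stable under right multiplication by
`h`, `g` and `y`, and finite dimensionality adds stability under inverses (`span_one_pair_eq_top`).
As `x` is rational in `h`, `g`, `y`, the space is all of `D`.

If `a + b y` is fixed with `a`, `b` in `R`, then `b t = 0`, so `b = 0`. This yields both `R = D^G`
and the independence of `1`, `y`.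

Finally `v = 1 - g h` satisfies `h v = q v h`. A nonzero `q`-commuting pair in a division algebra
induces an embedding of `D` when `q` is not a root of unity (`lift_injective`, `exists_lift`). The
embedding `x ↦ h`, `y ↦ v` has image `R`, because `g = (1 - v) h⁻¹`. -/

/-- Elements `X`, `Z` of a division ring acting on the image of a field `K` by the shifts
`u ↦ q u` and `u ↦ q⁻¹ u`, whose products are those of `x` and `Λ x⁻¹` in `k_q(x, y)`. -/
structure IsShiftPair {K D : Type*} [Field K] [DivisionRing D] (ι : K →+* D) (q u : K) (X Z : D) :
    Prop where
  q_ne : q ≠ 0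
  u_ne : u ≠ 0
  t_ne : u + u⁻¹ ≠ 0
  tp_ne : q * u + (q * u)⁻¹ ≠ 0
  tm_ne : q⁻¹ * u + (q⁻¹ * u)⁻¹ ≠ 0
  comm_q : ∀ d : D, SemiconjBy d (ι q) (ι q)
  shift_X : SemiconjBy X (ι u) (ι (q * u))
  shift_Z : SemiconjBy Z (ι u) (ι (q⁻¹ * u))
  X_mul_Z : X * Z = ι ((q * u)⁻¹ - u)
  Z_mul_X : Z * X = ι (u⁻¹ - q⁻¹ * u)

/-! ### Normal forms and identities for `h` and `g` over a commutative coefficient field -/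

namespace IsShiftPair

variable {K D : Type*} [Field K] [DivisionRing D] {ι : K →+* D}

theorem semiconj_inv {X : D} {a b : K} (h : SemiconjBy X (ι a) (ι b)) :
    SemiconjBy X (ι a⁻¹) (ι b⁻¹) := by
  rw [map_inv₀, map_inv₀]
  exact h.inv_right₀

theorem semiconj_mul {X : D} {a b c d : K} (h : SemiconjBy X (ι a) (ι b))
    (h' : SemiconjBy X (ι c) (ι d)) : SemiconjBy X (ι (a * c)) (ι (b * d)) := by
  rw [map_mul, map_mul]
  exact h.mul_right h'

theorem semiconj_add {X : D} {a b c d : K} (h : SemiconjBy X (ι a) (ι b))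
    (h' : SemiconjBy X (ι c) (ι d)) : SemiconjBy X (ι (a + c)) (ι (b + d)) := by
  rw [map_add, map_add]
  exact h.add_right h'

theorem normal_mul_map {X Z : D} {c cp cm : K} (hX : SemiconjBy X (ι c) (ι cp))
    (hZ : SemiconjBy Z (ι c) (ι cm)) (a b : K) :
    (ι a * X + ι b * Z) * ι c = ι (a * cp) * X + ι (b * cm) * Z := by
  rw [add_mul, mul_assoc, hX.eq, mul_assoc, hZ.eq, map_mul, map_mul, mul_assoc, mul_assoc]

/-- Moving coefficients to the left applies the shifts, and the mixed products `X Z`, `Z X` collapse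
to coefficients. The product of two linear forms in `X`, `Z` therefore has only the terms `X²`, `Z²`
and a constant, which reduces the quadratic identities below to identities in `K`. -/
theorem normal_mul_normal {X Z : D} {c cp cm d dp dm p r : K} (hX : SemiconjBy X (ι c) (ι cp))
    (hZ : SemiconjBy Z (ι c) (ι cm)) (hX' : SemiconjBy X (ι d) (ι dp))
    (hZ' : SemiconjBy Z (ι d) (ι dm)) (hXZ : X * Z = ι p) (hZX : Z * X = ι r) (a b : K) :
    (ι a * X + ι b * Z) * (ι c * X + ι d * Z) =
      ι (a * cp) * (X * X) + ι (b * dm) * (Z * Z) + ι (a * dp * p + b * cm * r) := by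
  rw [mul_add, ← mul_assoc, ← mul_assoc, normal_mul_map hX hZ, normal_mul_map hX' hZ', add_mul,
    add_mul, map_add, map_mul _ _ p, map_mul _ _ r, ← hXZ, ← hZX]
  simp only [mul_assoc]
  abel

variable (ι) in
/-- The element `(u + u⁻¹)⁻¹ (X - Z)`. -/
def hElt (u : K) (X Z : D) : D := ι (u + u⁻¹)⁻¹ * (X - Z)

variable (ι) in
/-- The element `(u + u⁻¹)⁻¹ (X u + Z u⁻¹)`. -/
def gElt (u : K) (X Z : D) : D := ι (u + u⁻¹)⁻¹ * (X * ι u + Z * ι u⁻¹)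

variable {q u : K} {X Z : D}

theorem hElt_eq (u : K) (X Z : D) : hElt ι u X Z =
    ι (u + u⁻¹)⁻¹ * X + ι (-(u + u⁻¹)⁻¹) * Z := by
  rw [hElt, map_neg, mul_sub, neg_mul, sub_eq_add_neg]

theorem gElt_eq (P : IsShiftPair ι q u X Z) : gElt ι u X Z =
    ι ((u + u⁻¹)⁻¹ * (q * u)) * X + ι ((u + u⁻¹)⁻¹ * (q⁻¹ * u)⁻¹) * Z := by
  rw [gElt, P.shift_X.eq, (semiconj_inv P.shift_Z).eq]
  simp only [map_mul, mul_add, mul_assoc]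

theorem shift_X_t (P : IsShiftPair ι q u X Z) :
    SemiconjBy X (ι (u + u⁻¹)) (ι (q * u + (q * u)⁻¹)) :=
  semiconj_add P.shift_X (semiconj_inv P.shift_X)

theorem shift_Z_t (P : IsShiftPair ι q u X Z) :
    SemiconjBy Z (ι (u + u⁻¹)) (ι (q⁻¹ * u + (q⁻¹ * u)⁻¹)) :=
  semiconj_add P.shift_Z (semiconj_inv P.shift_Z)

theorem shift_q_inv (P : IsShiftPair ι q u X Z) (d : D) : SemiconjBy d (ι q⁻¹) (ι q⁻¹) :=
  semiconj_inv (P.comm_q d)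

theorem h_mul_h (P : IsShiftPair ι q u X Z) : hElt ι u X Z * hElt ι u X Z =
    ι ((u + u⁻¹)⁻¹ * (q * u + (q * u)⁻¹)⁻¹) * (X * X) +
    ι ((u + u⁻¹)⁻¹ * (q⁻¹ * u + (q⁻¹ * u)⁻¹)⁻¹) * (Z * Z) +
    ι (-((u + u⁻¹)⁻¹ * (q * u + (q * u)⁻¹)⁻¹ * ((q * u)⁻¹ - u)) -
      (u + u⁻¹)⁻¹ * (q⁻¹ * u + (q⁻¹ * u)⁻¹)⁻¹ * (u⁻¹ - q⁻¹ * u)) := by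
  have hX := semiconj_inv P.shift_X_t
  have hZ := semiconj_inv P.shift_Z_t
  rw [hElt_eq, normal_mul_normal hX hZ (dp := -(q * u + (q * u)⁻¹)⁻¹)
    (dm := -(q⁻¹ * u + (q⁻¹ * u)⁻¹)⁻¹) (by simpa only [map_neg] using hX.neg_right)
    (by simpa only [map_neg] using hZ.neg_right) P.X_mul_Z P.Z_mul_X]
  congr 2 <;> [congr 2; skip] <;> ring

theorem shift_X_g₁ (P : IsShiftPair ι q u X Z) :
    SemiconjBy X (ι ((u + u⁻¹)⁻¹ * (q * u)))
      (ι ((q * u + (q * u)⁻¹)⁻¹ * (q * (q * u)))) :=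
  semiconj_mul (semiconj_inv P.shift_X_t) (semiconj_mul (P.comm_q X) P.shift_X)

theorem shift_Z_g₁ (P : IsShiftPair ι q u X Z) :
    SemiconjBy Z (ι ((u + u⁻¹)⁻¹ * (q * u)))
      (ι ((q⁻¹ * u + (q⁻¹ * u)⁻¹)⁻¹ * (q * (q⁻¹ * u)))) :=
  semiconj_mul (semiconj_inv P.shift_Z_t) (semiconj_mul (P.comm_q Z) P.shift_Z)

theorem shift_X_g₂ (P : IsShiftPair ι q u X Z) :
    SemiconjBy X (ι ((u + u⁻¹)⁻¹ * (q⁻¹ * u)⁻¹))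
      (ι ((q * u + (q * u)⁻¹)⁻¹ * (q⁻¹ * (q * u))⁻¹)) :=
  semiconj_mul (semiconj_inv P.shift_X_t)
    (semiconj_inv (semiconj_mul (P.shift_q_inv X) P.shift_X))

theorem shift_Z_g₂ (P : IsShiftPair ι q u X Z) :
    SemiconjBy Z (ι ((u + u⁻¹)⁻¹ * (q⁻¹ * u)⁻¹))
      (ι ((q⁻¹ * u + (q⁻¹ * u)⁻¹)⁻¹ * (q⁻¹ * (q⁻¹ * u))⁻¹)) :=
  semiconj_mul (semiconj_inv P.shift_Z_t)
    (semiconj_inv (semiconj_mul (P.shift_q_inv Z) P.shift_Z))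

theorem h_mul_g (P : IsShiftPair ι q u X Z) : hElt ι u X Z * gElt ι u X Z =
    ι ((u + u⁻¹)⁻¹ * ((q * u + (q * u)⁻¹)⁻¹ * (q * (q * u)))) * (X * X) +
    ι (-(u + u⁻¹)⁻¹ * ((q⁻¹ * u + (q⁻¹ * u)⁻¹)⁻¹ * (q⁻¹ * (q⁻¹ * u))⁻¹)) * (Z * Z) +
    ι ((u + u⁻¹)⁻¹ * ((q * u + (q * u)⁻¹)⁻¹ * (q⁻¹ * (q * u))⁻¹) * ((q * u)⁻¹ - u) +
      -(u + u⁻¹)⁻¹ * ((q⁻¹ * u + (q⁻¹ * u)⁻¹)⁻¹ * (q * (q⁻¹ * u))) * (u⁻¹ - q⁻¹ * u)) := by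
  rw [hElt_eq, P.gElt_eq, normal_mul_normal P.shift_X_g₁ P.shift_Z_g₁ P.shift_X_g₂ P.shift_Z_g₂
    P.X_mul_Z P.Z_mul_X]

theorem g_mul_g (P : IsShiftPair ι q u X Z) : gElt ι u X Z * gElt ι u X Z =
    ι ((u + u⁻¹)⁻¹ * (q * u) * ((q * u + (q * u)⁻¹)⁻¹ * (q * (q * u)))) * (X * X) +
    ι ((u + u⁻¹)⁻¹ * (q⁻¹ * u)⁻¹ *
      ((q⁻¹ * u + (q⁻¹ * u)⁻¹)⁻¹ * (q⁻¹ * (q⁻¹ * u))⁻¹)) * (Z * Z) +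
    ι ((u + u⁻¹)⁻¹ * (q * u) *
        ((q * u + (q * u)⁻¹)⁻¹ * (q⁻¹ * (q * u))⁻¹) * ((q * u)⁻¹ - u) +
      (u + u⁻¹)⁻¹ * (q⁻¹ * u)⁻¹ *
        ((q⁻¹ * u + (q⁻¹ * u)⁻¹)⁻¹ * (q * (q⁻¹ * u))) * (u⁻¹ - q⁻¹ * u)) := by
  rw [P.gElt_eq, normal_mul_normal P.shift_X_g₁ P.shift_Z_g₁ P.shift_X_g₂ P.shift_Z_g₂
    P.X_mul_Z P.Z_mul_X]

theorem g_mul_h (P : IsShiftPair ι q u X Z) : gElt ι u X Z * hElt ι u X Z =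
    ι ((u + u⁻¹)⁻¹ * (q * u) * (q * u + (q * u)⁻¹)⁻¹) * (X * X) +
    ι ((u + u⁻¹)⁻¹ * (q⁻¹ * u)⁻¹ * -(q⁻¹ * u + (q⁻¹ * u)⁻¹)⁻¹) * (Z * Z) +
    ι ((u + u⁻¹)⁻¹ * (q * u) * -(q * u + (q * u)⁻¹)⁻¹ * ((q * u)⁻¹ - u) +
      (u + u⁻¹)⁻¹ * (q⁻¹ * u)⁻¹ * (q⁻¹ * u + (q⁻¹ * u)⁻¹)⁻¹ * (u⁻¹ - q⁻¹ * u)) := by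
  have hX := semiconj_inv P.shift_X_t
  have hZ := semiconj_inv P.shift_Z_t
  rw [hElt_eq, P.gElt_eq, normal_mul_normal hX hZ (dp := -(q * u + (q * u)⁻¹)⁻¹)
    (dm := -(q⁻¹ * u + (q⁻¹ * u)⁻¹)⁻¹) (by simpa only [map_neg] using hX.neg_right)
    (by simpa only [map_neg] using hZ.neg_right) P.X_mul_Z P.Z_mul_X]

theorem t_inv (P : IsShiftPair ι q u X Z) :
    u ^ 2 + 1 ≠ 0 ∧ (u + u⁻¹)⁻¹ = u / (u ^ 2 + 1) := by
  have hu := P.u_ne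
  have e : u + u⁻¹ = (u ^ 2 + 1) / u := by field_simp
  have := P.t_ne
  rw [e] at this ⊢
  exact ⟨(div_ne_zero_iff.1 this).1, inv_div _ _⟩

theorem tp_inv (P : IsShiftPair ι q u X Z) :
    q ^ 2 * u ^ 2 + 1 ≠ 0 ∧ (q * u + (q * u)⁻¹)⁻¹ = q * u / (q ^ 2 * u ^ 2 + 1) := by
  have hu := P.u_ne
  have hq := P.q_ne
  have e : q * u + (q * u)⁻¹ = (q ^ 2 * u ^ 2 + 1) / (q * u) := by field_simp
  have := P.tp_ne
  rw [e] at this ⊢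
  exact ⟨(div_ne_zero_iff.1 this).1, inv_div _ _⟩

theorem tm_inv (P : IsShiftPair ι q u X Z) :
    u ^ 2 + q ^ 2 ≠ 0 ∧ (q⁻¹ * u + (q⁻¹ * u)⁻¹)⁻¹ = q * u / (u ^ 2 + q ^ 2) := by
  have hu := P.u_ne
  have hq := P.q_ne
  have e : q⁻¹ * u + (q⁻¹ * u)⁻¹ = (u ^ 2 + q ^ 2) / (q * u) := by field_simp
  have := P.tm_ne
  rw [e] at this ⊢
  exact ⟨(div_ne_zero_iff.1 this).1, inv_div _ _⟩

/-- The elements `h` and `g` satisfy the quantum Weyl relation. -/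
theorem weyl_relation (P : IsShiftPair ι q u X Z) :
    hElt ι u X Z * gElt ι u X Z - ι q * (gElt ι u X Z * hElt ι u X Z) = ι (1 - q) := by
  have hq := P.q_ne
  have hu := P.u_ne
  obtain ⟨hT, eT⟩ := P.t_inv
  obtain ⟨hTp, eTp⟩ := P.tp_inv
  have hTp' : u ^ 2 * q ^ 2 + 1 ≠ 0 := by rwa [mul_comm]
  obtain ⟨hTm, eTm⟩ := P.tm_inv
  -- It suffices to compare the coefficients of `X²`, of `Z²` and the constants; each comparison is
  -- an identity of rational functions in `q` and `u`.
  have e : ∀ A B C A' B' C' : K, A - q * A' = 0 → B - q * B' = 0 → C - q * C' = 1 - q →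
      ι A * (X * X) + ι B * (Z * Z) + ι C - ι q * (ι A' * (X * X) + ι B' * (Z * Z) + ι C') =
        ι (1 - q) := by
    intro A B C A' B' C' hA hB hC
    rw [← hC, sub_eq_zero.1 hA, sub_eq_zero.1 hB]
    simp only [map_sub, map_mul]
    noncomm_ring
  rw [P.h_mul_g, P.g_mul_h, eT, eTp, eTm]
  refine e _ _ _ _ _ _ ?_ ?_ ?_
  · ring
  · field_simp
    ring
  · field_simp
    ring

/-- The normal element `1 - g h` expresses `u - u⁻¹` through `h` and `g`. -/
theorem w_mul_v (P : IsShiftPair ι q u X Z) :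
    ι (u - u⁻¹) * (1 - gElt ι u X Z * hElt ι u X Z) =
      ι q * (hElt ι u X Z * hElt ι u X Z) - ι (q⁻¹ * q⁻¹) * (gElt ι u X Z * gElt ι u X Z) := by
  have hq := P.q_ne
  have hu := P.u_ne
  obtain ⟨hT, eT⟩ := P.t_inv
  obtain ⟨hTp, eTp⟩ := P.tp_inv
  have hTp' : u ^ 2 * q ^ 2 + 1 ≠ 0 := by rwa [mul_comm]
  obtain ⟨hTm, eTm⟩ := P.tm_inv
  have e : ∀ w r s A B C A' B' C' A'' B'' C'' : K, -w * A = r * A' - s * A'' →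
      -w * B = r * B' - s * B'' → w * (1 - C) = r * C' - s * C'' →
      ι w * (1 - (ι A * (X * X) + ι B * (Z * Z) + ι C)) =
        ι r * (ι A' * (X * X) + ι B' * (Z * Z) + ι C') -
        ι s * (ι A'' * (X * X) + ι B'' * (Z * Z) + ι C'') := by
    intro w r s A B C A' B' C' A'' B'' C'' hA hB hC
    have hA' := congrArg (fun a => ι a * (X * X)) hA
    have hB' := congrArg (fun a => ι a * (Z * Z)) hB
    have hC' := congrArg ι hC
    simp only [map_sub, map_mul, map_neg, map_one, sub_mul, neg_mul] at hA' hB' hC'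
    have : ι w * (1 - (ι A * (X * X) + ι B * (Z * Z) + ι C)) =
        -(ι w * ι A * (X * X)) + -(ι w * ι B * (Z * Z)) + ι w * (1 - ι C) := by noncomm_ring
    rw [this, hA', hB', hC']
    noncomm_ring
  rw [P.h_mul_h, P.g_mul_g, P.g_mul_h, eT, eTp, eTm]
  refine e _ _ _ _ _ _ _ _ _ _ _ _ ?_ ?_ ?_
  · field_simp
    ring
  · field_simp
  · field_simp
    ring

/-- Both sides are linear forms in `X` and `Z`, so two coefficient comparisons suffice. The point is
that the right side involves `u` only through `w = u - u⁻¹`, so that it lies in `R` once `w` does.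
-/
theorem t_mul_h_mul_t (P : IsShiftPair ι q u X Z) :
    ι (u + u⁻¹) * hElt ι u X Z * ι (u + u⁻¹) =
      ι (q⁻¹ - q) * gElt ι u X Z * ι (u - u⁻¹) +
      hElt ι u X Z * ι (2 * q⁻¹ + 2 * q + q * (u - u⁻¹) * (u - u⁻¹)) := by
  have hq := P.q_ne
  have hu := P.u_ne
  obtain ⟨hT, eT⟩ := P.t_inv
  have hwX : SemiconjBy X (ι (u - u⁻¹)) (ι (q * u - (q * u)⁻¹)) := by
    simpa only [map_sub] using P.shift_X.sub_right (semiconj_inv P.shift_X)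
  have hwZ : SemiconjBy Z (ι (u - u⁻¹)) (ι (q⁻¹ * u - (q⁻¹ * u)⁻¹)) := by
    simpa only [map_sub] using P.shift_Z.sub_right (semiconj_inv P.shift_Z)
  have h2 : ∀ d : D, SemiconjBy d (ι 2) (ι 2) := fun d => by
    rw [map_ofNat]; exact (Nat.cast_commute 2 d).symm
  have hcX := semiconj_add (semiconj_add (semiconj_mul (h2 X) (P.shift_q_inv X))
    (semiconj_mul (h2 X) (P.comm_q X))) (semiconj_mul (semiconj_mul (P.comm_q X) hwX) hwX)
  have hcZ := semiconj_add (semiconj_add (semiconj_mul (h2 Z) (P.shift_q_inv Z))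
    (semiconj_mul (h2 Z) (P.comm_q Z))) (semiconj_mul (semiconj_mul (P.comm_q Z) hwZ) hwZ)
  have e : ∀ a b c : K, ι a * (ι b * X + ι c * Z) = ι (a * b) * X + ι (a * c) * Z := by
    intro a b c
    simp only [map_mul, mul_add, mul_assoc]
  rw [hElt_eq, P.gElt_eq, e, e, normal_mul_map P.shift_X_t P.shift_Z_t, normal_mul_map hwX hwZ,
    normal_mul_map hcX hcZ, add_add_add_comm, ← add_mul, ← add_mul, ← map_add, ← map_add, eT]
  congr 3
  · field_simp
    ring
  · field_simp
    ring

theorem t_mul_g_mul_t (P : IsShiftPair ι q u X Z) :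
    ι (u + u⁻¹) * gElt ι u X Z * ι (u + u⁻¹) =
      gElt ι u X Z * ι (2 * q⁻¹ + 2 * q + q⁻¹ * (u - u⁻¹) * (u - u⁻¹)) +
      ι (q⁻¹ - q) * hElt ι u X Z * ι (u - u⁻¹) := by
  have hq := P.q_ne
  have hu := P.u_ne
  obtain ⟨hT, eT⟩ := P.t_inv
  have hwX : SemiconjBy X (ι (u - u⁻¹)) (ι (q * u - (q * u)⁻¹)) := by
    simpa only [map_sub] using P.shift_X.sub_right (semiconj_inv P.shift_X)
  have hwZ : SemiconjBy Z (ι (u - u⁻¹)) (ι (q⁻¹ * u - (q⁻¹ * u)⁻¹)) := by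
    simpa only [map_sub] using P.shift_Z.sub_right (semiconj_inv P.shift_Z)
  have h2 : ∀ d : D, SemiconjBy d (ι 2) (ι 2) := fun d => by
    rw [map_ofNat]; exact (Nat.cast_commute 2 d).symm
  have hcX := semiconj_add (semiconj_add (semiconj_mul (h2 X) (P.shift_q_inv X))
    (semiconj_mul (h2 X) (P.comm_q X))) (semiconj_mul (semiconj_mul (P.shift_q_inv X) hwX) hwX)
  have hcZ := semiconj_add (semiconj_add (semiconj_mul (h2 Z) (P.shift_q_inv Z))
    (semiconj_mul (h2 Z) (P.comm_q Z))) (semiconj_mul (semiconj_mul (P.shift_q_inv Z) hwZ) hwZ)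
  have e : ∀ a b c : K, ι a * (ι b * X + ι c * Z) = ι (a * b) * X + ι (a * c) * Z := by
    intro a b c
    simp only [map_mul, mul_add, mul_assoc]
  rw [hElt_eq, P.gElt_eq, e, e, normal_mul_map P.shift_X_t P.shift_Z_t, normal_mul_map hwX hwZ,
    normal_mul_map hcX hcZ, add_add_add_comm, ← add_mul, ← add_mul, ← map_add, ← map_add, eT]
  congr 3
  · field_simp
    ring
  · field_simp
    ring

/-- Adding `t h u⁻¹` to `t g` cancels the `Z` terms. This recovers `x` rationally from `h`, `g` and
`y`. -/
theorem X_mul_t (P : IsShiftPair ι q u X Z) :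
    X * ι (u + u⁻¹) = ι (u + u⁻¹) * (gElt ι u X Z + hElt ι u X Z * ι u⁻¹) := by
  have h : ι (u + u⁻¹) * ι (u + u⁻¹)⁻¹ = 1 := by
    rw [← map_mul, mul_inv_cancel₀ P.t_ne, map_one]
  rw [gElt, hElt, mul_assoc _ _ (ι u⁻¹), ← mul_add, ← mul_assoc, h, one_mul, map_add]
  noncomm_ring

/-- In the normal form of `1 - g h`, conjugation-type commutation with `u` separates the terms `X²`,
`Z²` and `1`, with factors `q²`, `q⁻²` and `1`. These are distinct, and the coefficient of `X²` is
nonzero. -/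
theorem one_sub_g_mul_h_ne_zero (P : IsShiftPair ι q u X Z) (hX : X ≠ 0) (hq2 : q ^ 2 ≠ 1)
    (hq4 : q ^ 4 ≠ 1) : 1 - gElt ι u X Z * hElt ι u X Z ≠ 0 := by
  have hq := P.q_ne
  have hu := P.u_ne
  intro h0
  rw [P.g_mul_h] at h0
  generalize hA : (u + u⁻¹)⁻¹ * (q * u) * (q * u + (q * u)⁻¹)⁻¹ = A at h0
  have hA0 : A ≠ 0 := hA ▸ mul_ne_zero (mul_ne_zero (inv_ne_zero P.t_ne) (mul_ne_zero hq hu))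
    (inv_ne_zero P.tp_ne)
  generalize (u + u⁻¹)⁻¹ * (q⁻¹ * u)⁻¹ * -(q⁻¹ * u + (q⁻¹ * u)⁻¹)⁻¹ = B at h0
  generalize (_ + _ : K) = C at h0
  have hXX : SemiconjBy (X * X) (ι u) (ι (q * (q * u))) :=
    (semiconj_mul (P.comm_q X) P.shift_X).mul_left P.shift_X
  have hZZ : SemiconjBy (Z * Z) (ι u) (ι (q⁻¹ * (q⁻¹ * u))) :=
    (semiconj_mul (P.shift_q_inv Z) P.shift_Z).mul_left P.shift_Z
  -- Subtracting `l u` times the relation from the relation times `u` removes the term whose factor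
  -- is `l`. Using `l = 1` and then `l = q⁻²` leaves only `X²`.
  have hlin : ∀ l a b c : K, ι a * (X * X) + ι b * (Z * Z) + ι c = 0 →
      ι (a * (q ^ 2 - l)) * (X * X) + ι (b * (q⁻¹ ^ 2 - l)) * (Z * Z) + ι (c * (1 - l)) = 0 := by
    intro l a b c h
    have h1 : (ι a * (X * X) + ι b * (Z * Z) + ι c) * ι u -
        ι (l * u) * (ι a * (X * X) + ι b * (Z * Z) + ι c) = 0 := by rw [h]; simp
    rw [add_mul, normal_mul_map hXX hZZ, ← map_mul] at h1
    refine (mul_eq_zero.1 ((?_ : ι u * _ = _).trans h1)).resolve_left (by simpa using hu)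
    simp only [mul_add, ← mul_assoc, ← map_mul]
    rw [show u * a * (q ^ 2 - l) = a * q * q * u - l * u * a by ring,
      show u * b * (q⁻¹ ^ 2 - l) = b * q⁻¹ * q⁻¹ * u - l * u * b by ring,
      show u * c * (1 - l) = c * u - l * u * c by ring]
    simp only [map_sub]
    noncomm_ring
  have h1 := hlin (q⁻¹ ^ 2) _ _ _ (hlin 1 (-A) (-B) (1 - C) (by
    rw [← h0]; simp only [map_neg, map_sub, map_one]; noncomm_ring))
  rw [sub_self, sub_self, mul_zero, mul_zero, zero_mul, map_zero, zero_mul, add_zero,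
    add_zero] at h1
  have h2 : q ^ 2 - q⁻¹ ^ 2 ≠ 0 := by
    intro h
    apply hq4
    field_simp at h
    linear_combination h
  have h3 : ι (-A * (q ^ 2 - 1) * (q ^ 2 - q⁻¹ ^ 2)) ≠ 0 := (map_ne_zero ι).2
    (mul_ne_zero (mul_ne_zero (neg_ne_zero.2 hA0) (sub_ne_zero.2 hq2)) h2)
  exact mul_ne_zero h3 (mul_ne_zero hX hX) h1

end IsShiftPair

/-! ### Bicentralizers and a criterion for degree at most two -/

/-- The bicentralizer of an element of a division ring. -/
def Subfield.bicentralizer {D : Type*} [DivisionRing D] (a : D) : Subfield D where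
  __ := Subring.centralizer (Subring.centralizer {a} : Set D)
  inv_mem' _ hx := Set.inv_mem_centralizer₀ hx

theorem Subfield.self_mem_bicentralizer {D : Type*} [DivisionRing D] (a : D) :
    a ∈ Subfield.bicentralizer a := by
  intro b hb
  exact (hb a rfl).symm

theorem Subfield.mem_bicentralizer_of_central {D : Type*} [DivisionRing D] (a : D) {c : D}
    (hc : ∀ d, Commute c d) : c ∈ Subfield.bicentralizer a :=
  fun d _ => (hc d).symm

/-- The bicentralizer of an element is commutative. -/
instance Subfield.instFieldBicentralizer {D : Type*} [DivisionRing D] (a : D) :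
    Field (Subfield.bicentralizer a) where
  __ := (inferInstance : DivisionRing (Subfield.bicentralizer a))
  mul_comm c d := by
    -- Since `a` centralizes itself, `c` commutes with `a`; thus `c` lies in the centralizer of `a`,
    -- all of which commutes with `d`.
    refine Subtype.ext (d.2 c.1 ?_).symm.symm
    rintro b rfl
    exact (c.2 b fun e he => by rw [Set.mem_singleton_iff.1 he])

/-- A division subring `R` and an element `y` such that `R + R y` absorbs left multiplication by `y`
of a set of elements of `R` which together with `y` generate the division ring. -/
theorem Subfield.span_one_pair_eq_top {D : Type*} [DivisionRing D] (R : Subfield D) (y : D)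
    (T : Set D) (hTR : T ⊆ R) (hyy : y * y ∈ Submodule.span R ({1, y} : Set D))
    (hyT : ∀ r ∈ T, y * r ∈ Submodule.span R ({1, y} : Set D))
    (hgen : Subfield.closure (insert y T) = ⊤) : Submodule.span R ({1, y} : Set D) = ⊤ := by
  set S := Submodule.span R ({1, y} : Set D) with hS
  have h1 : (1 : D) ∈ S := Submodule.subset_span (by simp)
  have hy : y ∈ S := Submodule.subset_span (by simp)
  have hfin : Module.Finite R S := Module.Finite.span_of_finite R (Set.toFinite _)
  have hstep : ∀ r : D, r ∈ S → y * r ∈ S → ∀ s ∈ S, s * r ∈ S := by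
    intro r hr hyr s hs
    obtain ⟨a, b, rfl⟩ := Submodule.mem_span_pair.1 hs
    rw [add_mul, smul_mul_assoc, smul_mul_assoc, one_mul]
    exact S.add_mem (S.smul_mem _ hr) (S.smul_mem _ hyr)
  -- The right multipliers preserving `S` form a division subring; it remains to see that it
  -- contains the generators.
  let M : Subfield D :=
    { carrier := {r | ∀ s ∈ S, s * r ∈ S}
      mul_mem' := fun {a b} ha hb s hs => by
        rw [← mul_assoc]; exact hb _ (ha s hs)
      one_mem' := fun s hs => by rwa [mul_one]
      add_mem' := fun {a b} ha hb s hs => by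
        rw [mul_add]; exact S.add_mem (ha s hs) (hb s hs)
      zero_mem' := fun s hs => by rw [mul_zero]; exact S.zero_mem
      neg_mem' := fun {a} ha s hs => by rw [mul_neg]; exact S.neg_mem (ha s hs)
      inv_mem' := fun r hr s hs => by
        by_cases hr0 : r = 0
        · rw [hr0, inv_zero, mul_zero]; exact S.zero_mem
        -- Right multiplication by `r` is left `R`-linear and injective on the finite-dimensional
        -- space `S`, hence surjective. So every `s` in `S` is `s' r`, and `s r⁻¹ = s'` stays in
        -- `S`.
        let f : S →ₗ[R] S :=
          { toFun := fun s => ⟨s.1 * r, hr s.1 s.2⟩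
            map_add' := fun a b => Subtype.ext (add_mul _ _ _)
            map_smul' := fun a b => Subtype.ext (smul_mul_assoc _ _ _) }
        have hf : Function.Injective f := fun a b hab =>
          Subtype.ext (mul_right_cancel₀ hr0 (congrArg Subtype.val hab))
        obtain ⟨s', hs'⟩ := LinearMap.surjective_of_injective hf ⟨s, hs⟩
        have : s'.1 * r = s := congrArg Subtype.val hs'
        rw [← this, mul_assoc, mul_inv_cancel₀ hr0, mul_one]
        exact s'.2 }
  have hM : M = ⊤ := by
    rw [eq_top_iff, ← hgen, Subfield.closure_le]
    rintro r (rfl | hr)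
    · exact hstep r hy hyy
    · refine hstep r ?_ (hyT r hr)
      have := S.smul_mem (⟨r, hTR hr⟩ : R) h1
      rwa [Subfield.smul_def, smul_eq_mul, mul_one] at this
  rw [eq_top_iff]
  rintro d -
  have : d ∈ M := hM ▸ Subfield.mem_top d
  simpa using this 1 h1

/-- Applying `A - μ m` kills the `m`-th term and rescales the others by nonzero factors, which
allows induction on the number of terms. -/
theorem Module.End.eq_zero_of_sum_eigenvectors_eq_zero {k V ι : Type*} [Field k] [AddCommGroup V]
    [Module k V] (A : Module.End k V) (μ : ι → k) (hμ : Function.Injective μ) (s : Finset ι)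
    (e : ι → V) (he : ∀ i, A (e i) = μ i • e i) (h0 : ∑ i ∈ s, e i = 0) : ∀ i ∈ s, e i = 0 := by
  classical
  induction s using Finset.induction_on generalizing e with
  | empty => simp
  | insert m s hm ih =>
    have h1 : ∑ i ∈ s, (μ i - μ m) • e i = 0 := by
      have h2 : A (∑ i ∈ insert m s, e i) - μ m • ∑ i ∈ insert m s, e i = 0 := by rw [h0]; simp
      rw [map_sum, Finset.smul_sum, ← Finset.sum_sub_distrib, Finset.sum_insert hm] at h2
      simpa [he, sub_smul] using h2
    have h3 := ih _ (fun i => by rw [map_smul, he, smul_comm]) h1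
    have h4 : ∀ i ∈ s, e i = 0 := fun i hi =>
      (smul_eq_zero.1 (h3 i hi)).resolve_left
        (sub_ne_zero.2 fun h => hm (hμ h ▸ hi))
    rw [Finset.sum_insert hm, Finset.sum_eq_zero h4, add_zero] at h0
    intro i hi
    rcases Finset.mem_insert.1 hi with rfl | hi
    exacts [h0, h4 i hi]

/-! ### Embeddings of the quantum plane into division algebras -/

namespace QuantumPlane

variable {k : Type*} [Field k] {q : kˣ} {E : Type*} [DivisionRing E] [Algebra k E]

theorem pow_injective_of_not_root (hq : ∀ n : ℕ, 1 ≤ n → q ^ n ≠ 1) :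
    Function.Injective fun n : ℕ => (q : k) ^ n := by
  have h : Function.Injective fun n : ℕ => q ^ n := by
    rw [injective_pow_iff_not_isOfFinOrder, isOfFinOrder_iff_pow_eq_one]
    rintro ⟨n, hn, h⟩
    exact hq n hn h
  intro m n hmn
  exact h (Units.ext (by simpa using hmn))

theorem semiconj_smul {a b : E} {c d : k} (h : SemiconjBy a b (c • b))
    {b' : E} (h' : SemiconjBy a b' (d • b')) : SemiconjBy a (b * b') ((c * d) • (b * b')) := by
  have := h.mul_right h'
  rwa [smul_mul_smul_comm] at this

theorem semiconj_smul_pow {a b : E} {c : k} (h : SemiconjBy a b (c • b)) (n : ℕ) :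
    SemiconjBy a (b ^ n) (c ^ n • b ^ n) := by
  have := h.pow_right n
  rwa [smul_pow] at this

/-- The `e i` are eigenvectors of the conjugation `c ↦ a c a⁻¹` with distinct eigenvalues. -/
theorem eq_zero_of_sum_semiconj {ι : Type*} (a : E) (ha : a ≠ 0) (μ : ι → k)
    (hμ : Function.Injective μ) (s : Finset ι) (e : ι → E)
    (he : ∀ i, SemiconjBy a (e i) (μ i • e i)) (h0 : ∑ i ∈ s, e i = 0) : ∀ i ∈ s, e i = 0 := by
  refine Module.End.eq_zero_of_sum_eigenvectors_eq_zero
    ((LinearMap.mulLeft k a).comp (LinearMap.mulRight k a⁻¹)) μ hμ s e (fun i => ?_) h0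
  simp only [LinearMap.comp_apply, LinearMap.mulLeft_apply, LinearMap.mulRight_apply]
  rw [← mul_assoc, (he i).eq, mul_assoc, mul_inv_cancel₀ ha, mul_one]

/-- The algebra homomorphism given by a pair of `q`-commuting elements. -/
noncomputable def lift (a b : E) (hab : a * b = (q : k) • (b * a)) : QuantumPlane k q →ₐ[k] E :=
  RingQuot.liftAlgHom k ⟨FreeAlgebra.lift k ![a, b], by
    rintro _ _ ⟨⟩
    simp [hab]⟩

theorem lift_x (a b : E) (hab : a * b = (q : k) • (b * a)) : lift a b hab (x k q) = a := by
  simp [lift, x]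

theorem lift_y (a b : E) (hab : a * b = (q : k) • (b * a)) : lift a b hab (y k q) = b := by
  simp [lift, y]

/-- Conjugation by `a` separates the powers of `b`, and conjugation by `b` separates the powers of
`a`, because the powers of `q` are distinct. Hence the monomials `b ^ i * a ^ j` are linearly
independent. -/
theorem lift_injective (hq : ∀ n : ℕ, 1 ≤ n → q ^ n ≠ 1) {a b : E}
    (hab : a * b = (q : k) • (b * a)) (ha : a ≠ 0) (hb : b ≠ 0) :
    Function.Injective (lift a b hab) := by
  rw [injective_iff_map_eq_zero]
  intro p hp
  obtain ⟨f, rfl⟩ := ofCoord_surjective k q p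
  have hinj := pow_injective_of_not_root hq
  have hab' : SemiconjBy a b ((q : k) • b) := by
    rw [SemiconjBy, hab, smul_mul_assoc]
  have hba : SemiconjBy b a ((q : k)⁻¹ • a) := by
    rw [SemiconjBy, smul_mul_assoc, hab, smul_smul, inv_mul_cancel₀ q.ne_zero, one_smul]
  let N := f.support.sup (fun p => p.1 + p.2) + 1
  have hN : f.support ⊆ Finset.range N ×ˢ Finset.range N := by
    intro p hp
    have : p.1 + p.2 ≤ f.support.sup (fun p => p.1 + p.2) :=
      Finset.le_sup (f := fun p : ℕ × ℕ => p.1 + p.2) hp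
    simp only [Finset.mem_product, Finset.mem_range, N]
    omega
  -- Grouped by powers of `b`: each inner sum commutes with `a`, so the `i`-th term has eigenvalue
  -- `q ^ i` under conjugation by `a`.
  have hsum : ∑ i ∈ Finset.range N, b ^ i * ∑ j ∈ Finset.range N, f (i, j) • a ^ j = 0 := by
    rw [ofCoord, Finsupp.linearCombination_apply, Finsupp.sum_of_support_subset f hN _
      (by simp), Finset.sum_product, map_sum] at hp
    rw [← hp]
    refine Finset.sum_congr rfl fun i _ => ?_
    rw [map_sum, Finset.mul_sum]
    refine Finset.sum_congr rfl fun j _ => ?_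
    rw [map_smul, mon, map_mul, map_pow, map_pow, lift_x, lift_y, mul_smul_comm]
  have h1 := eq_zero_of_sum_semiconj a ha (fun n : ℕ => (q : k) ^ n) hinj _ _ (fun i => by
    have hc : SemiconjBy a (∑ j ∈ Finset.range N, f (i, j) • a ^ j)
        ((1 : k) • ∑ j ∈ Finset.range N, f (i, j) • a ^ j) := by
      rw [one_smul]
      exact Commute.sum_right _ _ _ fun j _ => ((Commute.refl a).pow_right j).smul_right _
    simpa only [mul_one] using semiconj_smul (semiconj_smul_pow hab' i) hc) hsum
  have h2 : ∀ i ∈ Finset.range N, ∀ j ∈ Finset.range N, f (i, j) • a ^ j = 0 := by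
    intro i hi
    refine eq_zero_of_sum_semiconj b hb (fun n : ℕ => ((q : k)⁻¹) ^ n) (fun m n hmn => ?_) _ _
      (fun j => ?_) ((mul_eq_zero.1 (h1 i hi)).resolve_left (pow_ne_zero _ hb))
    · exact hinj (by simpa using hmn)
    · have := semiconj_smul_pow hba j
      rw [SemiconjBy] at this ⊢
      rw [mul_smul_comm, this, smul_comm]
      simp only [smul_mul_assoc]
  have hf : f = 0 := by
    ext p
    by_contra hne
    have hp := Finset.mem_product.1 (hN (Finsupp.mem_support_iff.2 hne))
    exact (smul_ne_zero hne (pow_ne_zero _ ha)) (h2 p.1 hp.1 p.2 hp.2)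
  rw [hf, map_zero]

end QuantumPlane

/-! ### Fractions, generation and the extension property of `k_q(x, y)` -/

namespace QDivisionRing

variable {k : Type*} [Field k] {q : kˣ} {E : Type*} [DivisionRing E] [Algebra k E]

theorem ofPlane_injective : Function.Injective (ofPlane k q) :=
  OreLocalization.numeratorHom_inj inf_le_left

theorem exists_fraction (d : QDivisionRing k q) :
    ∃ r s : QuantumPlane k q, s ≠ 0 ∧ d = (ofPlane k q s)⁻¹ * ofPlane k q r := by
  obtain ⟨r, s, hrs⟩ : ∃ (r : QuantumPlane k q) (s : (QuantumPlane k q)⁰),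
      ofPlane k q s * d = ofPlane k q r := by
    refine OreLocalization.ind (β := fun d => ∃ (r : QuantumPlane k q) (s : (QuantumPlane k q)⁰),
      ofPlane k q s * (show QDivisionRing k q from d) = ofPlane k q r) (fun r s => ⟨r, s, ?_⟩) d
    exact OreLocalization.mul_cancel (r := r) (s := s) (t := 1)
  have hs : (s : QuantumPlane k q) ≠ 0 := nonZeroDivisors.ne_zero s.2
  have h0 : ofPlane k q s ≠ 0 := (map_ne_zero_iff _ ofPlane_injective).2 hs
  exact ⟨r, s, hs, (eq_inv_mul_iff_mul_eq₀ h0).2 hrs⟩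

theorem x_ne_zero : x k q ≠ 0 := by
  refine (map_ne_zero_iff _ ofPlane_injective).2 fun h => ?_
  have h' := congrArg (QuantumPlane.coord k q) h
  have : QuantumPlane.x k q = QuantumPlane.mon k q (0, 1) := by simp [QuantumPlane.mon]
  rw [this, QuantumPlane.coord_mon, map_zero] at h'
  simp at h'

theorem y_ne_zero : y k q ≠ 0 := by
  refine (map_ne_zero_iff _ ofPlane_injective).2 fun h => ?_
  have h' := congrArg (QuantumPlane.coord k q) h
  have : QuantumPlane.y k q = QuantumPlane.mon k q (1, 0) := by simp [QuantumPlane.mon]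
  rw [this, QuantumPlane.coord_mon, map_zero] at h'
  simp at h'

theorem x_mul_y : x k q * y k q = (q : k) • (y k q * x k q) := by
  rw [x, y, ← map_mul, QuantumPlane.x_mul_y, map_smul, map_mul]

/-- The elements `x` and `y` generate `k_q(x, y)` as a division ring over `k`. -/
theorem eq_top_of_mem (M : Subfield (QDivisionRing k q))
    (hk : ∀ c : k, algebraMap k (QDivisionRing k q) c ∈ M) (hx : x k q ∈ M) (hy : y k q ∈ M) :
    M = ⊤ := by
  have hplane : ∀ r : QuantumPlane k q, ofPlane k q r ∈ M := by
    intro r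
    obtain ⟨f, rfl⟩ := QuantumPlane.ofCoord_surjective k q r
    rw [QuantumPlane.ofCoord, Finsupp.linearCombination_apply, Finsupp.sum, map_sum]
    refine sum_mem fun p _ => ?_
    rw [map_smul, Algebra.smul_def, QuantumPlane.mon, map_mul, map_pow, map_pow]
    exact mul_mem (hk _) (mul_mem (pow_mem hy _) (pow_mem hx _))
  rw [eq_top_iff]
  rintro d -
  obtain ⟨r, s, -, rfl⟩ := exists_fraction d
  exact mul_mem (inv_mem (hplane s)) (hplane r)

theorem algHom_ext {f g : QDivisionRing k q →ₐ[k] E} (hx : f (x k q) = g (x k q))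
    (hy : f (y k q) = g (y k q)) : f = g := by
  have h := eq_top_of_mem (RingHom.eqLocusField (f : QDivisionRing k q →+* E) g)
    (fun c => by simp [RingHom.eqLocusField]) hx hy
  ext d
  exact (h ▸ Subfield.mem_top d : d ∈ RingHom.eqLocusField (f : QDivisionRing k q →+* E) g)

/-- An injective algebra homomorphism from the quantum plane to a division algebra extends to
`k_q(x, y)`. -/
theorem exists_lift (hq : ∀ n : ℕ, 1 ≤ n → q ^ n ≠ 1) {a b : E}
    (hab : a * b = (q : k) • (b * a)) (ha : a ≠ 0) (hb : b ≠ 0) :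
    ∃ f : QDivisionRing k q →ₐ[k] E, f (x k q) = a ∧ f (y k q) = b := by
  let f₀ := QuantumPlane.lift a b hab
  have hinj : Function.Injective f₀ := QuantumPlane.lift_injective hq hab ha hb
  -- Injectivity makes every denominator invertible in `E`, so the universal property of the
  -- localization applies.
  let fS : (QuantumPlane k q)⁰ →* Eˣ :=
    { toFun := fun s => Units.mk0 (f₀ s)
        ((map_ne_zero_iff _ hinj).2 (nonZeroDivisors.ne_zero s.2))
      map_one' := Units.ext (by simp)
      map_mul' := fun s t => Units.ext (by simp) }
  let F : QDivisionRing k q →+* E :=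
    OreLocalization.universalHom (f₀ : QuantumPlane k q →+* E) fS fun _ => rfl
  have hF : ∀ r, F (ofPlane k q r) = f₀ r := fun r =>
    OreLocalization.universalHom_commutes (f₀ : QuantumPlane k q →+* E) fS fun _ => rfl
  refine ⟨{ F with
    commutes' := fun c => ?_ }, ?_, ?_⟩
  · have := hF (algebraMap k _ c)
    rwa [AlgHom.commutes, AlgHom.commutes] at this
  · exact (hF _).trans (QuantumPlane.lift_x a b hab)
  · exact (hF _).trans (QuantumPlane.lift_y a b hab)

end QDivisionRing

/-! ### The shift pair in `k_q(x, y)` and the spanning of `D` by `1` and `y` over `R` -/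

namespace QDivisionRing

variable {k : Type*} [Field k] {q : kˣ}

theorem semiconj_algebraMap (d : QDivisionRing k q) (c : k) :
    SemiconjBy d (algebraMap k _ c) (algebraMap k _ c) :=
  (Algebra.commutes c d).symm

theorem semiconj_x_y :
    SemiconjBy (x k q) (y k q) (algebraMap k _ (q : k) * y k q) := by
  rw [SemiconjBy, x_mul_y, Algebra.smul_def, mul_assoc]

theorem algebraMap_q_ne_zero : algebraMap k (QDivisionRing k q) (q : k) ≠ 0 :=
  (map_ne_zero _).2 q.ne_zero

theorem semiconj_x_inv_y :
    SemiconjBy (x k q)⁻¹ (y k q) ((algebraMap k _ (q : k))⁻¹ * y k q) := by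
  refine SemiconjBy.inv_symm_left₀ ?_
  have h := ((semiconj_algebraMap (x k q) (q : k)).inv_right₀).mul_right semiconj_x_y
  rwa [inv_mul_cancel_left₀ algebraMap_q_ne_zero] at h

/-- Conjugation by `x` multiplies `y²` by `q²` but fixes scalars. This is the only form of
transcendence of `y` needed to keep the denominators below nonzero. -/
theorem y_mul_y_ne (hq2 : (q : k) ^ 2 ≠ 1) (c : k) : y k q * y k q ≠ algebraMap k _ c := by
  intro h
  have h1 := semiconj_x_y.mul_right (semiconj_x_y (k := k) (q := q))
  have h2 := semiconj_algebraMap (x k q) c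
  rw [← h] at h2
  have h3 : y k q * y k q = algebraMap k _ ((q : k) ^ 2) * (y k q * y k q) := by
    refine mul_right_cancel₀ (x_ne_zero (k := k) (q := q)) (h2.eq.symm.trans (h1.eq.trans ?_))
    congr 1
    rw [map_pow, pow_two]
    exact Commute.mul_mul_mul_comm (semiconj_algebraMap (y k q) (q : k)) _ _
  have h4 : algebraMap k (QDivisionRing k q) ((q : k) ^ 2) = 1 :=
    (mul_eq_right₀ (mul_ne_zero y_ne_zero y_ne_zero)).1 h3.symm
  exact hq2 ((algebraMap k (QDivisionRing k q)).injective (h4.trans (map_one _).symm))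

variable (k q) in
/-- A commutative subfield of `k_q(x, y)` containing `k(y)`. -/
noncomputable abbrev yField : Subfield (QDivisionRing k q) := Subfield.bicentralizer (y k q)

variable (k q) in
/-- The element `y` of the subfield `yField`. -/
noncomputable def yElt : yField k q := ⟨y k q, Subfield.self_mem_bicentralizer _⟩

variable (k q) in
/-- The embedding of `k` into `yField`. -/
noncomputable def scalar : k →+* yField k q where
  toFun c := ⟨algebraMap k _ c,
    Subfield.mem_bicentralizer_of_central _ fun d => (semiconj_algebraMap d c).symm⟩
  map_one' := Subtype.ext (map_one _)
  map_zero' := Subtype.ext (map_zero _)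
  map_add' a b := Subtype.ext (map_add _ a b)
  map_mul' a b := Subtype.ext (map_mul _ a b)

theorem yElt_ne_zero : yElt k q ≠ 0 := fun h => y_ne_zero (congrArg Subtype.val h)

theorem yElt_sq_ne (hq2 : (q : k) ^ 2 ≠ 1) (c : k) : yElt k q * yElt k q ≠ scalar k q c :=
  fun h => y_mul_y_ne hq2 c (congrArg Subtype.val h)

/-- Vanishing would force `y² = -c⁻²`, a scalar. The cases `c = 1`, `q`, `q⁻¹` give the three
denominators of a shift pair. -/
theorem scaled_t_ne_zero (hq2 : (q : k) ^ 2 ≠ 1) {c : k} (hc : c ≠ 0) :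
    scalar k q c * yElt k q + (scalar k q c * yElt k q)⁻¹ ≠ 0 := by
  intro h
  have hc' : scalar k q c ≠ 0 := (map_ne_zero _).2 hc
  have hy := yElt_ne_zero (k := k) (q := q)
  refine yElt_sq_ne hq2 (-(c⁻¹ * c⁻¹)) ?_
  rw [map_neg, map_mul, map_inv₀]
  field_simp at h ⊢
  linear_combination h

theorem isShiftPair (hq2 : (q : k) ^ 2 ≠ 1) :
    IsShiftPair (yField k q).subtype (scalar k q q) (yElt k q) (x k q)
      (Lam k q * (x k q)⁻¹) where
  q_ne := (map_ne_zero _).2 q.ne_zero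
  u_ne := yElt_ne_zero
  t_ne := by simpa using scaled_t_ne_zero hq2 (one_ne_zero (α := k))
  tp_ne := scaled_t_ne_zero hq2 q.ne_zero
  tm_ne := by simpa using scaled_t_ne_zero hq2 (inv_ne_zero q.ne_zero)
  comm_q d := semiconj_algebraMap d _
  shift_X := semiconj_x_y
  shift_Z := by
    have h : SemiconjBy (x k q)⁻¹ ((yField k q).subtype (yElt k q))
        ((yField k q).subtype ((scalar k q q)⁻¹ * yElt k q)) := semiconj_x_inv_y
    refine SemiconjBy.mul_left ?_ h
    have e : Lam k q =
        (yField k q).subtype ((yElt k q)⁻¹ - scalar k q (q : k)⁻¹ * yElt k q) := by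
      rw [Lam, Algebra.smul_def]; rfl
    rw [e, SemiconjBy, ← map_mul, ← map_mul, mul_comm]
  X_mul_Z := by
    have h := ((semiconj_x_y (k := k) (q := q)).inv_right₀).sub_right
      ((semiconj_algebraMap (x k q) (q : k)⁻¹).mul_right semiconj_x_y)
    rw [Lam, Algebra.smul_def, ← mul_assoc, h.eq, mul_assoc, mul_inv_cancel₀ x_ne_zero, mul_one,
      map_inv₀, inv_mul_cancel_left₀ algebraMap_q_ne_zero]
    rfl
  Z_mul_X := by
    rw [mul_assoc, inv_mul_cancel₀ x_ne_zero, mul_one, Lam, Algebra.smul_def, map_inv₀]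
    rfl

theorem h_eq_hElt : h k q =
    IsShiftPair.hElt (yField k q).subtype (yElt k q) (x k q) (Lam k q * (x k q)⁻¹) := rfl

theorem g_eq_gElt : g k q =
    IsShiftPair.gElt (yField k q).subtype (yElt k q) (x k q) (Lam k q * (x k q)⁻¹) := rfl

theorem weyl_relation (hq2 : (q : k) ^ 2 ≠ 1) :
    h k q * g k q - (q : k) • (g k q * h k q) = algebraMap k _ (1 - (q : k)) := by
  have := (isShiftPair hq2).weyl_relation
  rw [Algebra.smul_def, map_sub, map_one]
  rwa [map_sub, map_one] at this

theorem h_ne_zero (hq2 : (q : k) ^ 2 ≠ 1) : h k q ≠ 0 := by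
  intro h0
  have := weyl_relation hq2
  rw [h0, zero_mul, mul_zero, smul_zero, sub_zero, eq_comm, map_eq_zero, sub_eq_zero] at this
  exact hq2 (by rw [← this, one_pow])

theorem one_sub_ne_zero (hq2 : (q : k) ^ 2 ≠ 1) (hq4 : (q : k) ^ 4 ≠ 1) :
    1 - g k q * h k q ≠ 0 := by
  have hinj := (scalar k q).injective
  exact (isShiftPair hq2).one_sub_g_mul_h_ne_zero x_ne_zero
    (fun e => hq2 (hinj (by rw [map_pow, e, map_one])))
    (fun e => hq4 (hinj (by rw [map_pow, e, map_one])))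

/-- Substituting `h g = q g h + 1 - q` turns the Weyl pair into a `q`-commuting pair. -/
theorem h_mul_one_sub (hq2 : (q : k) ^ 2 ≠ 1) :
    h k q * (1 - g k q * h k q) = (q : k) • ((1 - g k q * h k q) * h k q) := by
  have e := weyl_relation hq2
  rw [sub_eq_iff_eq_add] at e
  rw [mul_sub, ← mul_assoc, e, map_sub, map_one, Algebra.smul_def, Algebra.smul_def]
  noncomm_ring

theorem algebraMap_mem_R (c : k) : algebraMap k (QDivisionRing k q) c ∈ R k q :=
  Subfield.subset_closure (Or.inl ⟨c, rfl⟩)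

theorem h_mem_R : h k q ∈ R k q := Subfield.subset_closure (Or.inr (Or.inl rfl))

theorem g_mem_R : g k q ∈ R k q := Subfield.subset_closure (Or.inr (Or.inr rfl))

theorem w_mem_R (hq2 : (q : k) ^ 2 ≠ 1) (hq4 : (q : k) ^ 4 ≠ 1) :
    y k q - (y k q)⁻¹ ∈ R k q := by
  have e := (isShiftPair hq2).w_mul_v
  rw [← h_eq_hElt, ← g_eq_gElt, ← eq_mul_inv_iff_mul_eq₀ (one_sub_ne_zero hq2 hq4)] at e
  have hqR : (yField k q).subtype (scalar k q q) ∈ R k q := algebraMap_mem_R (q : k)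
  have e' : y k q - (y k q)⁻¹ = _ := e
  rw [e']
  refine mul_mem (sub_mem ?_ ?_) (inv_mem ?_)
  · exact mul_mem hqR (mul_mem h_mem_R h_mem_R)
  · rw [map_mul, map_inv₀]
    exact mul_mem (mul_mem (inv_mem hqR) (inv_mem hqR)) (mul_mem g_mem_R g_mem_R)
  · exact sub_mem (one_mem _) (mul_mem g_mem_R h_mem_R)

theorem t_ne_zero (hq2 : (q : k) ^ 2 ≠ 1) : y k q + (y k q)⁻¹ ≠ 0 := by
  intro h0
  exact (isShiftPair hq2).t_ne (Subtype.ext h0)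

theorem t_h_t_mem_R (hq2 : (q : k) ^ 2 ≠ 1) (hq4 : (q : k) ^ 4 ≠ 1) :
    (y k q + (y k q)⁻¹) * h k q * (y k q + (y k q)⁻¹) ∈ R k q := by
  have hqR : (yField k q).subtype (scalar k q q) ∈ R k q := algebraMap_mem_R (q : k)
  have hw : (yField k q).subtype (yElt k q - (yElt k q)⁻¹) ∈ R k q := w_mem_R hq2 hq4
  have h2 : (2 : QDivisionRing k q) ∈ R k q := ofNat_mem _ 2
  refine ((isShiftPair hq2).t_mul_h_mul_t :
    (y k q + (y k q)⁻¹) * h k q * (y k q + (y k q)⁻¹) = _) ▸ ?_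
  rw [← h_eq_hElt, ← g_eq_gElt, map_add (yField k q).subtype (_ + _), map_add _ (2 * _),
    map_mul _ (_ * _), map_mul _ 2, map_mul _ 2, map_mul _ (scalar k q q), map_sub _ _ (scalar k q q),
    map_inv₀ _ (scalar k q q), map_ofNat]
  exact add_mem (mul_mem (mul_mem (sub_mem (inv_mem hqR) hqR) g_mem_R) hw)
    (mul_mem h_mem_R (add_mem (add_mem (mul_mem h2 (inv_mem hqR)) (mul_mem h2 hqR))
      (mul_mem (mul_mem hqR hw) hw)))

theorem t_g_t_mem_R (hq2 : (q : k) ^ 2 ≠ 1) (hq4 : (q : k) ^ 4 ≠ 1) :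
    (y k q + (y k q)⁻¹) * g k q * (y k q + (y k q)⁻¹) ∈ R k q := by
  have hqR : (yField k q).subtype (scalar k q q) ∈ R k q := algebraMap_mem_R (q : k)
  have hw : (yField k q).subtype (yElt k q - (yElt k q)⁻¹) ∈ R k q := w_mem_R hq2 hq4
  have h2 : (2 : QDivisionRing k q) ∈ R k q := ofNat_mem _ 2
  refine ((isShiftPair hq2).t_mul_g_mul_t :
    (y k q + (y k q)⁻¹) * g k q * (y k q + (y k q)⁻¹) = _) ▸ ?_
  rw [← h_eq_hElt, ← g_eq_gElt, map_add (yField k q).subtype (_ + _), map_add _ (2 * _),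
    map_mul _ (_ * _), map_mul _ 2, map_mul _ 2, map_mul _ (scalar k q q)⁻¹,
    map_sub _ _ (scalar k q q), map_inv₀ _ (scalar k q q), map_ofNat]
  exact add_mem (mul_mem g_mem_R (add_mem (add_mem (mul_mem h2 (inv_mem hqR)) (mul_mem h2 hqR))
      (mul_mem (mul_mem (inv_mem hqR) hw) hw)))
    (mul_mem (mul_mem (sub_mem (inv_mem hqR) hqR) h_mem_R) hw)

theorem mul_y_mem {a : QDivisionRing k q} (ha : a ∈ R k q) :
    a * y k q ∈ Submodule.span (R k q) ({1, y k q} : Set (QDivisionRing k q)) :=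
  Submodule.smul_mem _ (⟨a, ha⟩ : R k q) (Submodule.subset_span (by simp))

theorem mem_span_of_mem_R {a : QDivisionRing k q} (ha : a ∈ R k q) :
    a ∈ Submodule.span (R k q) ({1, y k q} : Set (QDivisionRing k q)) := by
  have := Submodule.smul_mem (Submodule.span (R k q) ({1, y k q} : Set (QDivisionRing k q)))
    (⟨a, ha⟩ : R k q) (Submodule.subset_span (Set.mem_insert 1 _))
  rwa [Subfield.smul_def, smul_eq_mul, mul_one] at this

/-- From `t d t ∈ R` and `t² = w² + 4 ∈ R` follows `t d ∈ R t`; then `2 y = w + t` transfers this to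
`y`. Characteristic zero enters through division by `2`. -/
theorem y_mul_mem_span [CharZero k] (hq2 : (q : k) ^ 2 ≠ 1) (hq4 : (q : k) ^ 4 ≠ 1)
    {d : QDivisionRing k q} (hd : d ∈ R k q)
    (htd : (y k q + (y k q)⁻¹) * d * (y k q + (y k q)⁻¹) ∈ R k q) :
    y k q * d ∈ Submodule.span (R k q) ({1, y k q} : Set (QDivisionRing k q)) := by
  have hw := w_mem_R hq2 hq4
  have ht := t_ne_zero hq2
  have hy := y_ne_zero (k := k) (q := q)
  generalize hW : y k q - (y k q)⁻¹ = w at hw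
  generalize hT : y k q + (y k q)⁻¹ = t at ht htd
  have htw : t = 2 * y k q - w := by rw [← hT, ← hW]; noncomm_ring
  have htt : t * t = w * w + 4 := by
    have h1 := mul_inv_cancel₀ hy
    have h2 := inv_mul_cancel₀ hy
    rw [← hT, ← hW]
    simp only [mul_add, add_mul, mul_sub, sub_mul, h1, h2]
    rw [show (4 : QDivisionRing k q) = 1 + 1 + 1 + 1 by norm_num]
    abel
  have h2R : (2 : QDivisionRing k q) ∈ R k q := ofNat_mem _ 2
  have h20 : (2 : QDivisionRing k q) ≠ 0 := by
    rw [← map_ofNat (algebraMap k (QDivisionRing k q)) 2]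
    exact (map_ne_zero _).2 two_ne_zero
  have h4 : w * w + 4 ∈ R k q := add_mem (mul_mem hw hw) (ofNat_mem _ 4)
  -- Solving `t d = r t` gives `r = t d t⁻¹ = (t d t) t⁻²`, which is visibly in `R`.
  obtain ⟨r, hr⟩ : ∃ r, r = t * d * t * (w * w + 4)⁻¹ := ⟨_, rfl⟩
  have hrR : r ∈ R k q := hr ▸ mul_mem htd (inv_mem h4)
  have htd' : t * d = r * t := by
    rw [hr, ← htt, mul_inv_rev]
    simp only [← mul_assoc]
    rw [mul_inv_cancel_right₀ ht, inv_mul_cancel_right₀ ht]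
  have e : y k q * d = 2⁻¹ * (w * d - r * w) + r * y k q := by
    have : 2 * (y k q * d) = (w * d - r * w) + 2 * (r * y k q) := by
      rw [← mul_assoc, show 2 * y k q = w + t by rw [htw]; noncomm_ring, add_mul, htd', htw]
      noncomm_ring
    rw [eq_inv_mul_iff_mul_eq₀ h20 |>.2 this, mul_add, inv_mul_cancel_left₀ h20]
  rw [e]
  exact add_mem (mem_span_of_mem_R (mul_mem (inv_mem h2R)
    (sub_mem (mul_mem hw hd) (mul_mem hrR hw)))) (mul_y_mem hrR)

/-- As a left vector space over `R`, the division ring `k_q(x, y)` is spanned by `1` and `y`. -/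
theorem span_one_y [CharZero k] (hq2 : (q : k) ^ 2 ≠ 1) (hq4 : (q : k) ^ 4 ≠ 1) :
    Submodule.span (R k q) ({1, y k q} : Set (QDivisionRing k q)) = ⊤ := by
  refine Subfield.span_one_pair_eq_top (R k q) (y k q)
    (Set.range (algebraMap k (QDivisionRing k q)) ∪ {h k q, g k q}) Subfield.subset_closure ?_ ?_ ?_
  · have e : y k q * y k q = (y k q - (y k q)⁻¹) * y k q + 1 := by
      rw [sub_mul, inv_mul_cancel₀ y_ne_zero, sub_add_cancel]
    rw [e]
    exact add_mem (mul_y_mem (w_mem_R hq2 hq4)) (mem_span_of_mem_R (one_mem _))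
  · rintro r (⟨c, rfl⟩ | rfl | rfl)
    · rw [(semiconj_algebraMap (y k q) c).eq]
      exact mul_y_mem (algebraMap_mem_R c)
    · exact y_mul_mem_span hq2 hq4 h_mem_R (t_h_t_mem_R hq2 hq4)
    · exact y_mul_mem_span hq2 hq4 g_mem_R (t_g_t_mem_R hq2 hq4)
  · set M := Subfield.closure (insert (y k q)
      (Set.range (algebraMap k (QDivisionRing k q)) ∪ {h k q, g k q})) with hM
    have hy : y k q ∈ M := Subfield.subset_closure (Or.inl rfl)
    have hh : h k q ∈ M := Subfield.subset_closure (Or.inr (Or.inr (Or.inl rfl)))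
    have hg : g k q ∈ M := Subfield.subset_closure (Or.inr (Or.inr (Or.inr rfl)))
    refine eq_top_of_mem M (fun c => Subfield.subset_closure (Or.inr (Or.inl ⟨c, rfl⟩))) ?_ hy
    have e : x k q * (y k q + (y k q)⁻¹) =
      (y k q + (y k q)⁻¹) * (g k q + h k q * (y k q)⁻¹) := (isShiftPair hq2).X_mul_t
    rw [(eq_mul_inv_iff_mul_eq₀ (t_ne_zero hq2)).2 e]
    have ht : y k q + (y k q)⁻¹ ∈ M := add_mem hy (inv_mem hy)
    exact mul_mem (mul_mem ht (add_mem hg (mul_mem hh (inv_mem hy)))) (inv_mem ht)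

end QDivisionRing

/-- The operation-reversed subring of a division subring is a division ring. -/
noncomputable abbrev Subfield.opDivisionRing {D : Type*} [DivisionRing D] (R : Subfield D) :
    DivisionRing R.toSubring.op :=
  DivisionRing.ofIsUnitOrEqZero fun a => by
    by_cases ha : a = 0
    · exact Or.inr ha
    · have ha' : a.1 ≠ 0 := fun h => ha (Subtype.ext h)
      refine Or.inl ⟨⟨a, ⟨a.1⁻¹, ?_⟩, Subtype.ext (mul_inv_cancel₀ ha'),
        Subtype.ext (inv_mul_cancel₀ ha')⟩, rfl⟩
      have : (MulOpposite.unop a.1)⁻¹ ∈ R := inv_mem a.2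
      rwa [← MulOpposite.unop_inv] at this

/-! ### The involution, its fixed ring, the two dimensions and the isomorphism -/

namespace QDivisionRing

variable {k : Type*} [Field k] {q : kˣ}

theorem Lam_ne_zero (hq2 : (q : k) ^ 2 ≠ 1) : Lam k q ≠ 0 := by
  intro h0
  refine y_mul_y_ne hq2 (q : k) ?_
  rw [Lam, sub_eq_zero, Algebra.smul_def, map_inv₀, eq_inv_mul_iff_mul_eq₀ algebraMap_q_ne_zero]
    at h0
  calc y k q * y k q = algebraMap k _ (q : k) * (y k q)⁻¹ * y k q := by rw [h0]
    _ = _ := by rw [mul_assoc, inv_mul_cancel₀ y_ne_zero, mul_one]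

theorem x_mul_Lam_mul_x_inv : x k q * Lam k q * (x k q)⁻¹ =
    (q : k)⁻¹ • (y k q)⁻¹ - y k q := by
  have h := ((semiconj_x_y (k := k) (q := q)).inv_right₀).sub_right
    ((semiconj_algebraMap (x k q) (q : k)⁻¹).mul_right semiconj_x_y)
  rw [Lam, Algebra.smul_def, h.eq, mul_assoc, mul_inv_cancel₀ x_ne_zero, mul_one,
    map_inv₀, inv_mul_cancel_left₀ algebraMap_q_ne_zero, mul_inv_rev, Algebra.smul_def, map_inv₀]
  rw [(semiconj_algebraMap (y k q)⁻¹ (q : k)).inv_right₀.eq]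

/-- Inverting both `x` and `y` preserves the commutation factor `q`, and `Λ` commutes with `y`; so
the prescribed images of `x` and `y` again `q`-commute. -/
theorem phi_relation :
    Lam k q * (x k q)⁻¹ * -(y k q)⁻¹ = (q : k) • (-(y k q)⁻¹ * (Lam k q * (x k q)⁻¹)) := by
  have h₁ := (semiconj_x_inv_y (k := k) (q := q)).inv_right₀
  have h₂ : Commute (Lam k q) (y k q)⁻¹ :=
    (((Commute.refl _).inv_left₀).sub_left ((Commute.refl _).smul_left _)).inv_right₀
  rw [mul_neg, neg_mul, smul_neg, mul_assoc, h₁.eq, mul_inv_rev, inv_inv, ← mul_assoc (y k q)⁻¹,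
    ← h₂.eq, Algebra.smul_def, mul_assoc (y k q)⁻¹, Algebra.commutes, ← mul_assoc, ← mul_assoc,
    Algebra.commutes]

/-- The involution `φ`. -/
theorem exists_isPhi (hq : ∀ n : ℕ, 1 ≤ n → q ^ n ≠ 1) (hq2 : (q : k) ^ 2 ≠ 1) :
    ∃ φ : QDivisionRing k q ≃ₐ[k] QDivisionRing k q, IsPhi k q φ ∧ ∀ d, φ (φ d) = d := by
  obtain ⟨f, hx, hy⟩ := exists_lift hq phi_relation
    (mul_ne_zero (Lam_ne_zero hq2) (inv_ne_zero x_ne_zero))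
    (neg_ne_zero.2 (inv_ne_zero y_ne_zero))
  have hff : f.comp f = AlgHom.id k _ := by
    refine algHom_ext ?_ ?_
    -- Since `f` sends `Λ` to `x Λ x⁻¹`, it sends `Λ x⁻¹` to `x Λ x⁻¹ (Λ x⁻¹)⁻¹ = x`.
    · have hL : f (Lam k q) = x k q * Lam k q * (x k q)⁻¹ := by
        rw [x_mul_Lam_mul_x_inv, Lam, map_sub, map_smul, map_inv₀, hy, inv_neg, inv_inv, smul_neg]
        abel
      rw [AlgHom.comp_apply, hx, map_mul, map_inv₀, hx, hL, mul_inv_rev, inv_inv,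
        mul_assoc (_ * _), inv_mul_cancel_left₀ x_ne_zero, mul_inv_cancel_right₀ (Lam_ne_zero hq2)]
      rfl
    · rw [AlgHom.comp_apply, hy, map_neg, map_inv₀, hy, inv_neg, inv_inv, neg_neg]
      rfl
  exact ⟨AlgEquiv.ofAlgHom f f hff hff, ⟨hx, hy⟩, fun d => DFunLike.congr_fun hff d⟩

variable {φ : QDivisionRing k q ≃ₐ[k] QDivisionRing k q}

theorem mem_fixed_iff (d : QDivisionRing k q) :
    d ∈ FixedPoints.subalgebra k (QDivisionRing k q) (Subgroup.zpowers φ) ↔ φ d = d := by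
  constructor
  · intro h
    exact h ⟨φ, Subgroup.mem_zpowers φ⟩
  · rintro h ⟨σ, hσ⟩
    have : Subgroup.zpowers φ ≤ MulAction.stabilizer _ d := by
      rw [Subgroup.zpowers_le]
      exact h
    exact this hσ

theorem IsPhi.map_t (hφ : IsPhi k q φ) :
    φ (y k q + (y k q)⁻¹) = -(y k q + (y k q)⁻¹) := by
  rw [map_add, map_inv₀, hφ.2, inv_neg, inv_inv]
  abel

theorem IsPhi.map_h (hφ : IsPhi k q φ) (hφφ : ∀ d, φ (φ d) = d) : φ (h k q) = h k q := by
  have hx : φ (x k q) = Lam k q * (x k q)⁻¹ := hφ.1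
  have hx' : φ (Lam k q * (x k q)⁻¹) = x k q := by rw [← hx, hφφ]
  rw [h, map_mul, map_inv₀, hφ.map_t, map_sub, hx', hx, inv_neg, neg_mul, ← mul_neg, neg_sub]

theorem IsPhi.map_g (hφ : IsPhi k q φ) (hφφ : ∀ d, φ (φ d) = d) : φ (g k q) = g k q := by
  have hx : φ (x k q) = Lam k q * (x k q)⁻¹ := hφ.1
  have hx' : φ (Lam k q * (x k q)⁻¹) = x k q := by rw [← hx, hφφ]
  rw [g, map_mul, map_inv₀, hφ.map_t, map_add, map_mul, map_mul _ (_ * _), hx', hx, map_inv₀, hφ.2,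
    inv_neg, inv_neg, inv_inv]
  noncomm_ring

theorem IsPhi.map_of_mem_R (hφ : IsPhi k q φ) (hφφ : ∀ d, φ (φ d) = d) {d : QDivisionRing k q}
    (hd : d ∈ R k q) : φ d = d := by
  have : R k q ≤ RingHom.eqLocusField (φ : QDivisionRing k q →+* QDivisionRing k q)
      (RingHom.id _) := by
    rw [R, Subfield.closure_le]
    rintro _ (⟨c, rfl⟩ | rfl | rfl)
    · exact φ.commutes c
    · exact hφ.map_h hφφ
    · exact hφ.map_g hφφ
  exact this hd

/-- Comparing the element with its image leaves `b (y + y⁻¹) = 0`. This cancellation serves both the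
identification of the fixed ring and the independence of `1` and `y`. -/
theorem IsPhi.eq_zero_of_add_mul_y (hφ : IsPhi k q φ) (hq2 : (q : k) ^ 2 ≠ 1)
    {a b : QDivisionRing k q} (ha : φ a = a) (hb : φ b = b) (h : φ (a + b * y k q) = a + b * y k q) :
    b = 0 := by
  rw [map_add, map_mul, ha, hb, hφ.2, add_right_inj, eq_comm, ← sub_eq_zero, ← mul_sub,
    sub_neg_eq_add] at h
  exact (mul_eq_zero.1 h).resolve_right (t_ne_zero hq2)

theorem IsPhi.eq_zero_of_add_y_mul (hφ : IsPhi k q φ) (hq2 : (q : k) ^ 2 ≠ 1)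
    {a b : QDivisionRing k q} (ha : φ a = a) (hb : φ b = b) (h : φ (a + y k q * b) = a + y k q * b) :
    b = 0 := by
  rw [map_add, map_mul, ha, hb, hφ.2, add_right_inj, eq_comm, ← sub_eq_zero, ← sub_mul,
    sub_neg_eq_add] at h
  exact (mul_eq_zero.1 h).resolve_left (t_ne_zero hq2)

theorem IsPhi.mem_R_iff [CharZero k] (hφ : IsPhi k q φ) (hφφ : ∀ d, φ (φ d) = d)
    (hq2 : (q : k) ^ 2 ≠ 1) (hq4 : (q : k) ^ 4 ≠ 1) (d : QDivisionRing k q) :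
    d ∈ R k q ↔ φ d = d := by
  refine ⟨hφ.map_of_mem_R hφφ, fun hd => ?_⟩
  obtain ⟨a, b, rfl⟩ := Submodule.mem_span_pair.1
    (span_one_y hq2 hq4 ▸ Submodule.mem_top : d ∈ Submodule.span (R k q) {1, y k q})
  simp only [Subfield.smul_def, smul_eq_mul, mul_one] at hd ⊢
  rw [hφ.eq_zero_of_add_mul_y hq2 (hφ.map_of_mem_R hφφ a.2) (hφ.map_of_mem_R hφφ b.2) hd, zero_mul,
    add_zero]
  exact a.2

theorem IsPhi.rank_left [CharZero k] (hφ : IsPhi k q φ) (hφφ : ∀ d, φ (φ d) = d)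
    (hq2 : (q : k) ^ 2 ≠ 1) (hq4 : (q : k) ^ 4 ≠ 1) :
    Module.rank (R k q) (QDivisionRing k q) = 2 := by
  have hli : LinearIndependent (R k q) ![1, y k q] := by
    rw [LinearIndependent.pair_iff]
    intro a b hab
    simp only [Subfield.smul_def, smul_eq_mul, mul_one] at hab
    have hb := hφ.eq_zero_of_add_mul_y hq2 (hφ.map_of_mem_R hφφ a.2) (hφ.map_of_mem_R hφφ b.2)
      (by rw [hab, map_zero])
    rw [hb, zero_mul, add_zero] at hab
    exact ⟨Subtype.ext hab, Subtype.ext hb⟩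
  have B := Module.Basis.mk hli (by
    rw [Matrix.range_cons_cons_empty, span_one_y hq2 hq4])
  rw [rank_eq_card_basis B]
  simp

theorem IsPhi.rank_right [CharZero k] (hφ : IsPhi k q φ) (hφφ : ∀ d, φ (φ d) = d)
    (hq2 : (q : k) ^ 2 ≠ 1) (hq4 : (q : k) ^ 4 ≠ 1) :
    Module.rank (R k q).toSubring.op (QDivisionRing k q) = 2 := by
  have hsmul : ∀ (a : (R k q).toSubring.op) (d : QDivisionRing k q),
      a • d = d * MulOpposite.unop a.1 := fun _ _ => rfl
  have hfix : ∀ a : (R k q).toSubring.op, φ (MulOpposite.unop a.1) = MulOpposite.unop a.1 :=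
    fun a => hφ.map_of_mem_R hφφ a.2
  have hli : LinearIndependent (R k q).toSubring.op ![1, y k q] := by
    rw [LinearIndependent.pair_iff]
    intro a b hab
    simp only [hsmul, one_mul] at hab
    have hb := hφ.eq_zero_of_add_y_mul hq2 (hfix a) (hfix b) (by rw [hab, map_zero])
    rw [hb, mul_zero, add_zero] at hab
    exact ⟨Subtype.ext (MulOpposite.unop_injective hab),
      Subtype.ext (MulOpposite.unop_injective hb)⟩
  have : StrongRankCondition (R k q).toSubring.op := by
    let _ := (R k q).opDivisionRing
    infer_instance
  have B := Module.Basis.mk hli (by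
    rintro d -
    rw [Matrix.range_cons_cons_empty]
    have ht := t_ne_zero hq2
    -- Both `d - φ d` and `t` change sign under `φ`, so `b` is fixed. Since `φ (y b) = -y⁻¹ b`, the
    -- equation `t b = d - φ d` says exactly that `d - y b` is fixed too.
    obtain ⟨b, hb⟩ : ∃ b, b = (y k q + (y k q)⁻¹)⁻¹ * (d - φ d) := ⟨_, rfl⟩
    have hbfix : φ b = b := by
      rw [hb, map_mul, map_inv₀, hφ.map_t, map_sub, hφφ, inv_neg, neg_mul, ← mul_neg, neg_sub]
    have htb : (y k q + (y k q)⁻¹) * b = d - φ d := by rw [hb, mul_inv_cancel_left₀ ht]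
    have hafix : φ (d - y k q * b) = d - y k q * b := by
      rw [map_sub, map_mul, hbfix, hφ.2]
      rw [add_mul, eq_sub_iff_add_eq] at htb
      rw [← sub_eq_zero]
      nth_rewrite 2 [← htb]
      noncomm_ring
    refine Submodule.mem_span_pair.2
      ⟨⟨MulOpposite.op (d - y k q * b), (hφ.mem_R_iff hφφ hq2 hq4 _).2 hafix⟩,
        ⟨MulOpposite.op b, (hφ.mem_R_iff hφφ hq2 hq4 _).2 hbfix⟩, ?_⟩
    simp only [hsmul, one_mul, MulOpposite.unop_op, sub_add_cancel])
  rw [rank_eq_card_basis B]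
  simp

/-- The division subring `R` is the image of `k_q(x, y)` under `x ↦ h`, `y ↦ 1 - g h`. -/
theorem exists_algHom_range_eq_R (hq : ∀ n : ℕ, 1 ≤ n → q ^ n ≠ 1) (hq2 : (q : k) ^ 2 ≠ 1)
    (hq4 : (q : k) ^ 4 ≠ 1) :
    ∃ f : QDivisionRing k q →ₐ[k] QDivisionRing k q, ∀ d, d ∈ f.range ↔ d ∈ R k q := by
  obtain ⟨f, hx, hy⟩ := exists_lift hq (h_mul_one_sub hq2) (h_ne_zero hq2)
    (one_sub_ne_zero hq2 hq4)
  refine ⟨f, fun d => ⟨?_, fun hd => ?_⟩⟩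
  · rintro ⟨e, rfl⟩
    have := eq_top_of_mem ((R k q).comap (f : QDivisionRing k q →+* QDivisionRing k q))
      (fun c => by
        rw [Subfield.mem_comap]
        exact (f.commutes c).symm ▸ algebraMap_mem_R c)
      (by
        rw [Subfield.mem_comap]
        exact hx.symm ▸ h_mem_R)
      (by
        rw [Subfield.mem_comap]
        exact hy.symm ▸ sub_mem (one_mem _) (mul_mem g_mem_R h_mem_R))
    exact (this ▸ Subfield.mem_top e :
      e ∈ (R k q).comap (f : QDivisionRing k q →+* QDivisionRing k q))
  · have : R k q ≤ (f : QDivisionRing k q →+* QDivisionRing k q).fieldRange := by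
      rw [R, Subfield.closure_le]
      rintro _ (⟨c, rfl⟩ | rfl | rfl)
      · exact ⟨algebraMap k _ c, f.commutes c⟩
      · exact ⟨x k q, hx⟩
      -- The image of `1 - y` is `g h`, so dividing by the image `h` of `x` on the right gives `g`.
      · refine ⟨(1 - y k q) * (x k q)⁻¹, ?_⟩
        change f _ = _
        rw [map_mul, map_sub, map_one, map_inv₀, hx, hy, sub_sub_cancel,
          mul_inv_cancel_right₀ (h_ne_zero hq2)]
    exact this hd

end QDivisionRing

theorem theorem3p1p1 (k : Type*) [Field k] [CharZero k] (q : kˣ)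
    (hq : ∀ n : ℕ, 1 ≤ n → q ^ n ≠ 1) :
    ∃ φ : QDivisionRing k q ≃ₐ[k] QDivisionRing k q,
      -- `φ` is the unique `k`-algebra automorphism with the prescribed values on generators
      QDivisionRing.IsPhi k q φ ∧
      (∀ ψ : QDivisionRing k q ≃ₐ[k] QDivisionRing k q, QDivisionRing.IsPhi k q ψ → ψ = φ) ∧
      orderOf φ = 2 ∧
      -- the fixed ring of the group generated by `φ` is isomorphic to `D` as a `k`-algebra
      Nonempty (FixedPoints.subalgebra k (QDivisionRing k q) (Subgroup.zpowers φ) ≃ₐ[k]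
        QDivisionRing k q) ∧
      -- `h` and `g` are fixed and satisfy a quantum Weyl relation
      QDivisionRing.h k q ∈
        FixedPoints.subalgebra k (QDivisionRing k q) (Subgroup.zpowers φ) ∧
      QDivisionRing.g k q ∈
        FixedPoints.subalgebra k (QDivisionRing k q) (Subgroup.zpowers φ) ∧
      QDivisionRing.h k q * QDivisionRing.g k q -
          (q : k) • (QDivisionRing.g k q * QDivisionRing.h k q) =
        algebraMap k (QDivisionRing k q) (1 - (q : k)) ∧
      -- the division ring generated by `h` and `g` is the whole fixed ring
      (QDivisionRing.R k q : Set (QDivisionRing k q)) =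
        FixedPoints.subalgebra k (QDivisionRing k q) (Subgroup.zpowers φ) ∧
      -- and `D` has degree two over it, on the left and on the right
      Module.rank (QDivisionRing.R k q) (QDivisionRing k q) = 2 ∧
      Module.rank (QDivisionRing.R k q).toSubring.op (QDivisionRing k q) = 2 := by
  have hpow : ∀ n : ℕ, 1 ≤ n → (q : k) ^ n ≠ 1 := fun n hn h =>
    hq n hn (Units.ext (by rw [Units.val_pow_eq_pow_val, h, Units.val_one]))
  have hq2 := hpow 2 (by norm_num)
  have hq4 := hpow 4 (by norm_num)
  obtain ⟨φ, hφ, hφφ⟩ := QDivisionRing.exists_isPhi hq hq2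
  have hmem : ∀ d, d ∈ FixedPoints.subalgebra k (QDivisionRing k q) (Subgroup.zpowers φ) ↔
      d ∈ QDivisionRing.R k q := fun d => by
    rw [QDivisionRing.mem_fixed_iff, hφ.mem_R_iff hφφ hq2 hq4]
  refine ⟨φ, hφ, fun ψ hψ => ?_, ?_, ?_, (hmem _).2 QDivisionRing.h_mem_R,
    (hmem _).2 QDivisionRing.g_mem_R, QDivisionRing.weyl_relation hq2, ?_,
    hφ.rank_left hφφ hq2 hq4, hφ.rank_right hφφ hq2 hq4⟩
  · have : (ψ : QDivisionRing k q →ₐ[k] QDivisionRing k q) = φ :=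
      QDivisionRing.algHom_ext (hψ.1.trans hφ.1.symm) (hψ.2.trans hφ.2.symm)
    exact AlgEquiv.ext fun d => DFunLike.congr_fun this d
  -- If `φ` were the identity, then `y = -y⁻¹`, contradicting `y + y⁻¹ ≠ 0`.
  · refine orderOf_eq_prime (AlgEquiv.ext fun d => by rw [pow_two]; exact hφφ d) fun h1 => ?_
    have hy : φ (QDivisionRing.y k q) = QDivisionRing.y k q := by rw [h1]; rfl
    rw [hφ.2, eq_comm, ← sub_eq_zero, sub_neg_eq_add] at hy
    exact QDivisionRing.t_ne_zero hq2 hy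
  · obtain ⟨f, hf⟩ := QDivisionRing.exists_algHom_range_eq_R hq hq2 hq4
    have hrange : f.range = FixedPoints.subalgebra k (QDivisionRing k q) (Subgroup.zpowers φ) :=
      SetLike.ext fun d => (hf d).trans (hmem d).symm
    exact ⟨((AlgEquiv.ofInjective f (f : QDivisionRing k q →+* QDivisionRing k q).injective).trans
      (Subalgebra.equivOfEq _ _ hrange)).symm⟩
  · exact Set.ext fun d => (hmem d).symm
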